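/- Let $n\ge 0$ be an integer, let $g$ be a finite-dimensional simple Lie algebra over $\mathbb C$ with a non-degenerate symmetric invariant bilinear form $(\cdot|\cdot)$, and let $\sigma_1,\dots,\sigma_n$ be commuting automorphisms of $g$ of finite orders $m_1,\dots,m_n$. Put $\Gamma=m_1\mathbb Z\oplus\cdots\oplus m_n\mathbb Z$, fix primitive $m_i$-th roots of unity $\zeta_i$, and for $k\in\mathbb Z^n$ let $g(\bar k)=\{x\in g:\sigma_i x=\zeta_i^{k_i}x,\ 1\le i\le n\}$. Assume that the multiloop algebra $LT=\bigoplus_{k\in\mathbb Z^n}g(\bar k)\otimes t^k$ is a Lie torus, that is: (1) $g(\bar 0)$ is a simple Lie algebra; fix a Cartan subalgebra $h(\bar 0)$ of it, let $\Delta_0$ be the root system of $(g(\bar 0),h(\bar 0))$, and put $\Delta_{0,en}=\Delta_0\cup 2\Delta_{0,sh}$ if $\Delta_0$ is of type $B_l$ for some $l\ge1$ ($B_1=A_1$ with all roots short; $\Delta_{0,sh}$ denotes the short roots) and $\Delta_{0,en}=\Delta_0$ otherwise; (2) if $k\notin\Gamma$ and $g(\bar k)\ne0$, then $g(\bar k)=U\oplus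 W$ as a $g(\bar 0)$-module, where $U$ is trivial and $W$ is either zero or irreducible of dimension greater than $1$ with all its nonzero $h(\bar 0)$-weights in $\Delta_{0,en}$; (3) the group generated by $\sigma_1,\dots,\sigma_n$ has order $m_1\cdots m_n$. Let $Z$ be the space spanned by symbols $t^rK_i$ ($r\in\Gamma$, $1\le i\le n$) modulo the span of the elements $\sum_i r_it^rK_i$ ($r\in\Gamma$), and let $S_n(m)$ be the span of the $D(u,r)=\sum_iu_it^rd_i$ with $r\in\Gamma$, $u\in\mathbb C^n$, $\sum_iu_ir_i=0$, where $d_i=t_i\,\partial/\partial t_i$. Let $\tau=LT\oplus Z\oplus S_n(m)$ be the twisted toroidal extended affine Lie algebra: $Z$ commutes with $LT\oplus Z$, and the other brackets are the restrictions of $$[x\otimes t^p,y\otimes t^q]=[x,y]\otimes t^{p+q}+(x|y)\sum_ip_it^{p+q}K_i,\qquad [t^pd_a,x\otimes t^q]=q_a\,x\otimes t^{p+q},$$ $$[t^pd_a,t^qK_b]=q_at^{p+q}K_b+\delta_{ab}\sum_ip_it^{p+q}K_i,\qquad [t^pd_a,t^qd_b]=q_at^{p+q}d_b-p_bt^{p+q}d_a+\phi(t^pd_a,t^qd_b),$$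 where $\phi$ is a fixed linear combination of the cocycles $\phi_1(t^pd_a,t^qd_b)=-q_ap_b\sum_ip_it^{p+q}K_i$ and $\phi_2(t^pd_a,t^qd_b)=-p_aq_b\sum_ip_it^{p+q}K_i$. Let $H=h(\bar 0)\oplus\sum_i\mathbb CK_i\oplus\sum_i\mathbb Cd_i$. Extend $\lambda\in h(\bar 0)^*$ to $H$ by zero on all $K_i,d_i$, and for $\beta\in\mathbb C^n$ let $\delta_\beta\in H^*$ vanish on $h(\bar 0)$ and all $K_i$, with $\delta_\beta(d_i)=\beta_i$. For $\alpha\in h(\bar 0)^*$ let $g(\bar k,\alpha)=\{x\in g(\bar k):[h,x]=\alpha(h)x\ \forall h\in h(\bar 0)\}$. Fix a base of $\Delta_0$; write $\alpha>0$ if $\alpha$ is a nonzero combination of simple roots with coefficients in $\mathbb Z_{\ge0}$, and $\alpha<0$ if $-\alpha>0$. Put $$\tau^{\pm}=\bigoplus_{\pm\alpha>0,\ k\in\mathbb Z^n}g(\bar k,\alpha)\otimes t^k,\qquad \tau^0=\bigoplus_{k\in\mathbb Z^n}g(\bar k,0)\otimes t^k\oplus Z\oplus S_n(m).$$ Let $V$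 be an irreducible integrable $\tau$-module, i.e. $V=\bigoplus_{\mu\in H^*}V_\mu$ with $V_\mu=\{v\in V:hv=\mu(h)v\ \forall h\in H\}$ finite-dimensional, and every element of $g(\bar k,\alpha)\otimes t^k$ with $0\ne\alpha\in\Delta_{0,en}$, $k\in\mathbb Z^n$, acts locally nilpotently on $V$. Assume that $K_1,\dots,K_n$ act trivially on $V$. Let $V_+=\{v\in V:\tau^+v=0\}$. Then: (i) $V_+\neq0$; (ii) $V_+$ is an irreducible $\tau^0$-module; (iii) $V=U(\tau^-)V_+$; (iv) there is a unique $\bar\lambda\in h(\bar 0)^*$ such that, for some $\beta\in\mathbb C^n$, every weight of $V_+$ has the form $\bar\lambda+\delta_{r+\beta}$ with $r\in\mathbb Z^n$; and this $\bar\lambda$ is dominant integral for $g(\bar 0)$. -/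

import Mathlib

open scoped BigOperators

noncomputable section

namespace ToroidalEALA

/-! ## Bilinear maps on spaces of finitely supported families -/

section Bil

variable {P X Y Z : Type*} [AddCommGroup X] [Module ℂ X] [AddCommGroup Y] [Module ℂ Y]
  [AddCommGroup Z] [Module ℂ Z]

/-- The bilinear map determined by `(single p x, single q y) ↦ f p q x y`. -/
def bil (f : P → P → X →ₗ[ℂ] Y →ₗ[ℂ] Z) : (P →₀ X) →ₗ[ℂ] (P →₀ Y) →ₗ[ℂ] Z :=
  Finsupp.lsum ℂ fun p => LinearMap.flip (Finsupp.lsum ℂ fun q => (f p q).flip)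

@[simp] theorem bil_single (f : P → P → X →ₗ[ℂ] Y →ₗ[ℂ] Z) (p q : P) (x : X) (y : Y) :
    bil f (Finsupp.single p x) (Finsupp.single q y) = f p q x y := by
  simp [bil]

theorem bil_self (f : P → P → X →ₗ[ℂ] X →ₗ[ℂ] Z)
    (hf : ∀ p q x y, f p q x y = - f q p y x) (A : P →₀ X) : bil f A A = 0 := by
  have h : ∀ A B, bil f A B = - bil f B A := by
    intro A B
    induction A using Finsupp.induction_linear with
    | zero => simp
    | add A A' h h' => simp [h, h']; abel
    | single p x =>
      induction B using Finsupp.induction_linear with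
      | zero => simp
      | add A A' h h' => simp [h, h']; abel
      | single q y => simpa using hf p q x y
  have := h A A
  have h2 : (2 : ℂ) • bil f A A = 0 := by
    rw [two_smul]; nth_rewrite 1 [this]; simp
  simpa using h2

theorem skew_of_self {f : X →ₗ[ℂ] X →ₗ[ℂ] Z} (hf : ∀ x, f x x = 0) (x y : X) :
    f x y = - f y x := by
  have h := hf (x + y)
  simp only [map_add, LinearMap.add_apply, hf, zero_add, add_zero] at h
  exact eq_neg_of_add_eq_zero_right h

end Bil

/-! ## The full toroidal Lie algebra -/

section Full

variable (n : ℕ) (g : Type*) [LieRing g] [LieAlgebra ℂ g]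

/-- The exponent lattice `ℤⁿ`. -/
abbrev Lat := Fin n → ℤ

variable {n} in
/-- A lattice point seen in `ℂⁿ`. -/
def toC (r : Lat n) : Fin n → ℂ := fun i => (r i : ℂ)

variable {n} in
/-- The pairing `(u | v) = ∑ uᵢ vᵢ` on `ℂⁿ`. -/
def dot (u v : Fin n → ℂ) : ℂ := ∑ i, u i * v i

/-- The loop algebra `g ⊗ A_n`; `Finsupp.single p x` is `x(p) = x ⊗ t^p`. -/
abbrev Loop := Lat n →₀ g

/-- `Der(A_n)`; `Finsupp.single r u` is the vector field `D(u, r) = ∑ uᵢ t^r dᵢ`. -/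
abbrev Der := Lat n →₀ (Fin n → ℂ)

/-- `Ω_{A_n}`; `Finsupp.single r w` is `∑ wᵢ t^r Kᵢ`. -/
abbrev Omega := Lat n →₀ (Fin n → ℂ)

/-- The subspace `dA_n` spanned by the elements `∑ kᵢ t^k Kᵢ`. -/
def dA : Submodule ℂ (Omega n) :=
  Submodule.span ℂ (Set.range fun k : Lat n => Finsupp.single k (toC k))

/-- `Ω_{A_n} / dA_n`. -/
abbrev Ctr := Omega n ⧸ dA n

variable {n} in
/-- The class of `∑ wᵢ t^r Kᵢ` in `Ω_{A_n} / dA_n`, linear in `w`. -/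
def om (r : Lat n) : (Fin n → ℂ) →ₗ[ℂ] Ctr n :=
  (dA n).mkQ ∘ₗ Finsupp.lsingle r

variable {n} {g}

@[simp] theorem toC_add (r s : Lat n) : toC (r + s) = toC r + toC s := by
  ext; simp [toC]

@[simp] theorem toC_zero : toC (0 : Lat n) = 0 := by
  ext; simp [toC]

@[simp] theorem om_self (r : Lat n) : om r (toC r) = 0 := by
  simp only [om, LinearMap.comp_apply, Submodule.mkQ_apply, Submodule.Quotient.mk_eq_zero]
  exact Submodule.subset_span ⟨r, rfl⟩

theorem om_add_swap (p q : Lat n) : om (p + q) (toC q) = - om (p + q) (toC p) := by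
  have := om_self (p + q)
  rw [toC_add, map_add] at this
  exact eq_neg_of_add_eq_zero_right this

theorem dot_comm (u v : Fin n → ℂ) : dot u v = dot v u := by
  simp [dot, mul_comm]

@[simp] theorem dot_add (u v w : Fin n → ℂ) : dot u (v + w) = dot u v + dot u w := by
  simp [dot, mul_add, Finset.sum_add_distrib]

@[simp] theorem add_dot (u v w : Fin n → ℂ) : dot (u + v) w = dot u w + dot v w := by
  simp [dot, add_mul, Finset.sum_add_distrib]

@[simp] theorem dot_sub (u v w : Fin n → ℂ) : dot u (v - w) = dot u v - dot u w := by
  simp [dot, mul_sub, Finset.sum_sub_distrib]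

@[simp] theorem sub_dot (u v w : Fin n → ℂ) : dot (u - v) w = dot u w - dot v w := by
  simp [dot, sub_mul, Finset.sum_sub_distrib]

@[simp] theorem dot_smul (c : ℂ) (u v : Fin n → ℂ) : dot u (c • v) = c * dot u v := by
  simp [dot, Finset.mul_sum, mul_left_comm]

@[simp] theorem smul_dot (c : ℂ) (u v : Fin n → ℂ) : dot (c • u) v = c * dot u v := by
  simp [dot, Finset.mul_sum, mul_assoc]

@[simp] theorem dot_zero (u : Fin n → ℂ) : dot u 0 = 0 := by simp [dot]

@[simp] theorem zero_dot (u : Fin n → ℂ) : dot 0 u = 0 := by simp [dot]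

/-- `(x(p), y(q)) ↦ [x, y](p + q)`. -/
def loopBr : Loop n g →ₗ[ℂ] Loop n g →ₗ[ℂ] Loop n g :=
  bil fun p q => LinearMap.mk₂ ℂ (fun x y => Finsupp.single (p + q) ⁅x, y⁆)
    (by simp) (by simp) (by simp) (by simp)

/-- `(x(p), y(q)) ↦ (x | y) ∑ pᵢ t^{p+q} Kᵢ` for the Killing form `( | )`. -/
def loopCocycle : Loop n g →ₗ[ℂ] Loop n g →ₗ[ℂ] Ctr n :=
  bil fun p q => LinearMap.mk₂ ℂ (fun x y => killingForm ℂ g x y • om (p + q) (toC p))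
    (by simp [add_smul]) (by simp [mul_smul]) (by simp [add_smul]) (by simp [mul_smul])

/-- `(D(u, p), y(q)) ↦ (u | q) y(p + q)`. -/
def derLoop : Der n →ₗ[ℂ] Loop n g →ₗ[ℂ] Loop n g :=
  bil fun p q => LinearMap.mk₂ ℂ (fun u y => Finsupp.single (p + q) (dot u (toC q) • y))
    (by intros; simp only [add_dot, add_smul, Finsupp.single_add])
    (by intros; simp only [smul_dot, mul_smul, Finsupp.smul_single])
    (by intros; simp only [smul_add, Finsupp.single_add])
    (by intros; rw [Finsupp.smul_single, smul_comm])

/-- `(D(u, p), ∑ wᵢ t^q Kᵢ) ↦ (u | q) ∑ wᵢ t^{p+q} Kᵢ + (u | w) ∑ pᵢ t^{p+q} Kᵢ`. -/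
def derOmega : Der n →ₗ[ℂ] Omega n →ₗ[ℂ] Ctr n :=
  bil fun p q => LinearMap.mk₂ ℂ
    (fun u w => dot u (toC q) • om (p + q) w + dot u w • om (p + q) (toC p))
    (by intros; simp only [add_dot]; module)
    (by intros; simp only [smul_dot]; module)
    (by intros; simp only [dot_add, map_add]; module)
    (by intros; simp only [dot_smul, map_smul]; module)

theorem dA_le_ker : dA n ≤ LinearMap.ker (derOmega (n := n)).flip := by
  refine Submodule.span_le.2 ?_
  rintro _ ⟨q, rfl⟩
  simp only [SetLike.mem_coe, LinearMap.mem_ker]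
  refine LinearMap.ext fun E => ?_
  induction E using Finsupp.induction_linear with
  | zero => simp
  | add A A' h h' => rw [map_add, h, h']; simp
  | single p u => simp [derOmega, om_add_swap]

/-- The action of `Der(A_n)` on `Ω_{A_n} / dA_n` induced by `derOmega`. -/
def derCtr : Der n →ₗ[ℂ] Ctr n →ₗ[ℂ] Ctr n :=
  ((dA n).liftQ (derOmega (n := n)).flip dA_le_ker).flip

/-- `(D(u, p), D(v, q)) ↦ D((u | q) v - (v | p) u, p + q)`. -/
def derBr : Der n →ₗ[ℂ] Der n →ₗ[ℂ] Der n :=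
  bil fun p q => LinearMap.mk₂ ℂ
    (fun u v => Finsupp.single (p + q) (dot u (toC q) • v - dot v (toC p) • u))
    (by intros; rw [← Finsupp.single_add]; congr 1; simp only [add_dot]; module)
    (by intros; rw [Finsupp.smul_single]; congr 1; simp only [smul_dot]; module)
    (by intros; rw [← Finsupp.single_add]; congr 1; simp only [add_dot]; module)
    (by intros; rw [Finsupp.smul_single]; congr 1; simp only [smul_dot]; module)

/-- The cocycle `φ₁(t^p d_a, t^q d_b) = - q_a p_b ∑ pᵢ t^{p+q} Kᵢ`. -/
def phi₁ : Der n →ₗ[ℂ] Der n →ₗ[ℂ] Ctr n :=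
  bil fun p q => LinearMap.mk₂ ℂ
    (fun u v => (-(dot u (toC q) * dot v (toC p))) • om (p + q) (toC p))
    (by intros; simp only [add_dot]; module)
    (by intros; simp only [smul_dot]; module)
    (by intros; simp only [add_dot]; module)
    (by intros; simp only [smul_dot]; module)

/-- The cocycle `φ₂(t^p d_a, t^q d_b) = - p_a q_b ∑ pᵢ t^{p+q} Kᵢ`. -/
def phi₂ : Der n →ₗ[ℂ] Der n →ₗ[ℂ] Ctr n :=
  bil fun p q => LinearMap.mk₂ ℂ
    (fun u v => (-(dot u (toC p) * dot v (toC q))) • om (p + q) (toC p))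
    (by intros; simp only [add_dot]; module)
    (by intros; simp only [smul_dot]; module)
    (by intros; simp only [add_dot]; module)
    (by intros; simp only [smul_dot]; module)

@[simp] theorem loopBr_single (p q : Lat n) (x y : g) :
    loopBr (Finsupp.single p x) (Finsupp.single q y) = Finsupp.single (p + q) ⁅x, y⁆ := by
  simp [loopBr]

@[simp] theorem loopCocycle_single (p q : Lat n) (x y : g) :
    loopCocycle (Finsupp.single p x) (Finsupp.single q y) =
      killingForm ℂ g x y • om (p + q) (toC p) := by
  simp [loopCocycle]

@[simp] theorem derLoop_single (p q : Lat n) (u : Fin n → ℂ) (y : g) :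
    derLoop (Finsupp.single p u) (Finsupp.single q y) =
      Finsupp.single (p + q) (dot u (toC q) • y) := by
  simp [derLoop]

@[simp] theorem derCtr_om (p q : Lat n) (u w : Fin n → ℂ) :
    derCtr (Finsupp.single p u) (om q w) =
      dot u (toC q) • om (p + q) w + dot u w • om (p + q) (toC p) := by
  simp [derCtr, om, derOmega]

@[simp] theorem derBr_single (p q : Lat n) (u v : Fin n → ℂ) :
    derBr (Finsupp.single p u) (Finsupp.single q v) =
      Finsupp.single (p + q) (dot u (toC q) • v - dot v (toC p) • u) := by
  simp [derBr]

@[simp] theorem phi₁_single (p q : Lat n) (u v : Fin n → ℂ) :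
    phi₁ (Finsupp.single p u) (Finsupp.single q v) =
      (-(dot u (toC q) * dot v (toC p))) • om (p + q) (toC p) := by
  simp [phi₁]

@[simp] theorem phi₂_single (p q : Lat n) (u v : Fin n → ℂ) :
    phi₂ (Finsupp.single p u) (Finsupp.single q v) =
      (-(dot u (toC p) * dot v (toC q))) • om (p + q) (toC p) := by
  simp [phi₂]

theorem loopBr_self (A : Loop n g) : loopBr A A = 0 :=
  bil_self _ (fun p q x y => by
    simp only [LinearMap.mk₂_apply]
    rw [← Finsupp.single_neg, lie_skew, add_comm]) A

theorem loopCocycle_self (A : Loop n g) : loopCocycle A A = 0 :=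
  bil_self _ (fun p q x y => by
    simp only [LinearMap.mk₂_apply]
    rw [LieModule.traceForm_comm, add_comm p q, om_add_swap q p, smul_neg]) A

theorem derBr_self (A : Der n) : derBr A A = 0 :=
  bil_self _ (fun p q x y => by
    simp only [LinearMap.mk₂_apply]
    rw [← Finsupp.single_neg, neg_sub, add_comm]) A

theorem phi₁_self (A : Der n) : phi₁ A A = 0 :=
  bil_self _ (fun p q x y => by
    simp only [LinearMap.mk₂_apply]
    rw [add_comm p q, om_add_swap q p, mul_comm]; module) A

theorem phi₂_self (A : Der n) : phi₂ A A = 0 :=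
  bil_self _ (fun p q x y => by
    simp only [LinearMap.mk₂_apply]
    rw [add_comm p q, om_add_swap q p, mul_comm]; module) A

theorem loop_jac (A B C : Loop n g) :
    loopBr A (loopBr B C) = loopBr (loopBr A B) C + loopBr B (loopBr A C) := by
  induction A using Finsupp.induction_linear with
  | zero => simp
  | add A A' h h' => simp only [map_add, LinearMap.add_apply, h, h']; abel
  | single p x =>
  induction B using Finsupp.induction_linear with
  | zero => simp
  | add A A' h h' => simp only [map_add, LinearMap.add_apply, h, h']; abel
  | single q y =>
  induction C using Finsupp.induction_linear with
  | zero => simp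
  | add A A' h h' => simp only [map_add, h, h']; abel
  | single r z =>
    simp only [loopBr_single]
    rw [leibniz_lie x y z, Finsupp.single_add, add_assoc, add_left_comm q p r]

theorem loopCocycle_jac (A B C : Loop n g) :
    loopCocycle A (loopBr B C) = loopCocycle (loopBr A B) C + loopCocycle B (loopBr A C) := by
  induction A using Finsupp.induction_linear with
  | zero => simp
  | add A A' h h' => simp only [map_add, LinearMap.add_apply, h, h']; abel
  | single p x =>
  induction B using Finsupp.induction_linear with
  | zero => simp
  | add A A' h h' => simp only [map_add, LinearMap.add_apply, h, h']; abel
  | single q y =>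
  induction C using Finsupp.induction_linear with
  | zero => simp
  | add A A' h h' => simp only [map_add, h, h']; abel
  | single r z =>
    simp only [loopBr_single, loopCocycle_single]
    have h1 : killingForm ℂ g x ⁅y, z⁆ = killingForm ℂ g ⁅x, y⁆ z :=
      (LieModule.traceForm_apply_lie_apply ℂ g g x y z).symm
    have h2 : killingForm ℂ g y ⁅x, z⁆ = - killingForm ℂ g ⁅x, y⁆ z := by
      rw [← LieModule.traceForm_apply_lie_apply, ← lie_skew, map_neg]; rfl
    rw [h1, h2, add_left_comm q p r, add_assoc, toC_add, map_add]
    module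

theorem derLoop_loopBr (A : Der n) (B C : Loop n g) :
    derLoop A (loopBr B C) = loopBr (derLoop A B) C + loopBr B (derLoop A C) := by
  induction A using Finsupp.induction_linear with
  | zero => simp
  | add A A' h h' => simp only [map_add, LinearMap.add_apply, h, h']; abel
  | single p u =>
  induction B using Finsupp.induction_linear with
  | zero => simp
  | add A A' h h' => simp only [map_add, LinearMap.add_apply, h, h']; abel
  | single q y =>
  induction C using Finsupp.induction_linear with
  | zero => simp
  | add A A' h h' => simp only [map_add, h, h']; abel
  | single r z =>
    simp only [loopBr_single, derLoop_single, toC_add, dot_add, add_smul, lie_smul, smul_lie]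
    rw [add_left_comm q p r, add_assoc, Finsupp.single_add]

theorem derBr_derLoop (A B : Der n) (C : Loop n g) :
    derLoop A (derLoop B C) = derLoop (derBr A B) C + derLoop B (derLoop A C) := by
  induction A using Finsupp.induction_linear with
  | zero => simp
  | add A A' h h' => simp only [map_add, LinearMap.add_apply, h, h']; abel
  | single p u =>
  induction B using Finsupp.induction_linear with
  | zero => simp
  | add A A' h h' => simp only [map_add, LinearMap.add_apply, h, h']; abel
  | single q v =>
  induction C using Finsupp.induction_linear with
  | zero => simp
  | add A A' h h' => simp only [map_add, h, h']; abel
  | single r z =>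
    simp only [derBr_single, derLoop_single]
    rw [add_left_comm q p r, add_assoc, ← Finsupp.single_add]
    congr 1
    simp only [toC_add, dot_add, sub_dot, smul_dot]
    module

theorem derCtr_loopCocycle (A : Der n) (B C : Loop n g) :
    derCtr A (loopCocycle B C) =
      loopCocycle (derLoop A B) C + loopCocycle B (derLoop A C) := by
  induction A using Finsupp.induction_linear with
  | zero => simp
  | add A A' h h' => simp only [map_add, LinearMap.add_apply, h, h']; abel
  | single p u =>
  induction B using Finsupp.induction_linear with
  | zero => simp
  | add A A' h h' => simp only [map_add, LinearMap.add_apply, h, h']; abel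
  | single q y =>
  induction C using Finsupp.induction_linear with
  | zero => simp
  | add A A' h h' => simp only [map_add, h, h']; abel
  | single r z =>
    simp only [loopCocycle_single, derLoop_single, derCtr_om, map_smul, LinearMap.smul_apply]
    rw [add_left_comm q p r, add_assoc]
    simp only [toC_add, dot_add, map_add, smul_eq_mul]
    module

theorem omega_induction {p : Ctr n → Prop} (h0 : p 0) (hadd : ∀ z w, p z → p w → p (z + w))
    (hom : ∀ r w, p (om r w)) (z : Ctr n) : p z := by
  obtain ⟨z, rfl⟩ := Submodule.Quotient.mk_surjective _ z
  induction z using Finsupp.induction_linear with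
  | zero => simpa using h0
  | add z w hz hw => simpa using hadd _ _ hz hw
  | single r w => exact hom r w

theorem derBr_derCtr (A B : Der n) (z : Ctr n) :
    derCtr A (derCtr B z) = derCtr (derBr A B) z + derCtr B (derCtr A z) := by
  induction A using Finsupp.induction_linear with
  | zero => simp
  | add A A' h h' => simp only [map_add, LinearMap.add_apply, h, h']; abel
  | single p u =>
  induction B using Finsupp.induction_linear with
  | zero => simp
  | add A A' h h' => simp only [map_add, LinearMap.add_apply, h, h']; abel
  | single q v =>
  induction z using omega_induction with
  | h0 => simp
  | hadd A A' h h' => simp only [map_add, h, h']; abel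
  | hom r w =>
    simp only [derBr_single, derCtr_om, map_add, map_smul]
    rw [add_left_comm q p r, add_assoc p q r]
    simp only [toC_add, dot_add, map_add, sub_dot, smul_dot]
    module

theorem der_jac (A B C : Der n) :
    derBr A (derBr B C) = derBr (derBr A B) C + derBr B (derBr A C) := by
  induction A using Finsupp.induction_linear with
  | zero => simp
  | add A A' h h' => simp only [map_add, LinearMap.add_apply, h, h']; abel
  | single p u =>
  induction B using Finsupp.induction_linear with
  | zero => simp
  | add A A' h h' => simp only [map_add, LinearMap.add_apply, h, h']; abel
  | single q v =>
  induction C using Finsupp.induction_linear with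
  | zero => simp
  | add A A' h h' => simp only [map_add, h, h']; abel
  | single r w =>
    simp only [derBr_single]
    rw [add_left_comm q p r, add_assoc, ← Finsupp.single_add]
    congr 1
    simp only [toC_add, dot_add, sub_dot, smul_dot]
    module

theorem phi₁_jac (A B C : Der n) :
    phi₁ A (derBr B C) + derCtr A (phi₁ B C) =
      phi₁ (derBr A B) C - derCtr C (phi₁ A B) + phi₁ B (derBr A C) + derCtr B (phi₁ A C) := by
  induction A using Finsupp.induction_linear with
  | zero => simp
  | add A A' h h' =>
    simp only [map_add, LinearMap.add_apply]
    have e := congrArg₂ (· + ·) h h'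
    rw [← sub_eq_zero] at e ⊢
    rw [← e]; abel
  | single p u =>
  induction B using Finsupp.induction_linear with
  | zero => simp
  | add A A' h h' =>
    simp only [map_add, LinearMap.add_apply]
    have e := congrArg₂ (· + ·) h h'
    rw [← sub_eq_zero] at e ⊢
    rw [← e]; abel
  | single q v =>
  induction C using Finsupp.induction_linear with
  | zero => simp
  | add A A' h h' =>
    simp only [map_add, LinearMap.add_apply]
    have e := congrArg₂ (· + ·) h h'
    rw [← sub_eq_zero] at e ⊢
    rw [← e]; abel
  | single r w =>
    simp only [derBr_single, phi₁_single, derCtr_om, map_smul]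
    rw [add_left_comm q p r, add_assoc, add_comm r (p + q), add_assoc]
    have hr : om (p + (q + r)) (toC r) =
        - om (p + (q + r)) (toC p) - om (p + (q + r)) (toC q) := by
      have := om_self (p + (q + r))
      simp only [toC_add, map_add] at this
      rw [sub_eq_add_neg, ← neg_add, eq_neg_iff_add_eq_zero, ← this]; abel
    simp only [toC_add, dot_add, map_add, sub_dot, smul_dot, hr]
    module

theorem phi₂_jac (A B C : Der n) :
    phi₂ A (derBr B C) + derCtr A (phi₂ B C) =
      phi₂ (derBr A B) C - derCtr C (phi₂ A B) + phi₂ B (derBr A C) + derCtr B (phi₂ A C) := by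
  induction A using Finsupp.induction_linear with
  | zero => simp
  | add A A' h h' =>
    simp only [map_add, LinearMap.add_apply]
    have e := congrArg₂ (· + ·) h h'
    rw [← sub_eq_zero] at e ⊢
    rw [← e]; abel
  | single p u =>
  induction B using Finsupp.induction_linear with
  | zero => simp
  | add A A' h h' =>
    simp only [map_add, LinearMap.add_apply]
    have e := congrArg₂ (· + ·) h h'
    rw [← sub_eq_zero] at e ⊢
    rw [← e]; abel
  | single q v =>
  induction C using Finsupp.induction_linear with
  | zero => simp
  | add A A' h h' =>
    simp only [map_add, LinearMap.add_apply]
    have e := congrArg₂ (· + ·) h h'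
    rw [← sub_eq_zero] at e ⊢
    rw [← e]; abel
  | single r w =>
    simp only [derBr_single, phi₂_single, derCtr_om, map_smul]
    rw [add_left_comm q p r, add_assoc, add_comm r (p + q), add_assoc]
    have hr : om (p + (q + r)) (toC r) =
        - om (p + (q + r)) (toC p) - om (p + (q + r)) (toC q) := by
      have := om_self (p + (q + r))
      simp only [toC_add, map_add] at this
      rw [sub_eq_add_neg, ← neg_add, eq_neg_iff_add_eq_zero, ← this]; abel
    simp only [toC_add, dot_add, map_add, sub_dot, smul_dot, hr]
    module

variable (n g) in
/-- The full toroidal Lie algebra `(g ⊗ A_n) ⊕ Ω_{A_n} / dA_n ⊕ Der(A_n)` for the invariant form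
`(x | y) = κ * killingForm x y` on `g` and the cocycle `φ = a φ₁ + b φ₂`.  (For `g` simple over `ℂ`
the non-degenerate invariant symmetric bilinear forms are exactly the non-zero multiples of the
Killing form.) -/
def FullToroidal (_κ _a _b : ℂ) : Type _ := Loop n g × Ctr n × Der n

namespace FullToroidal

variable {κ a b : ℂ}

instance : AddCommGroup (FullToroidal n g κ a b) :=
  inferInstanceAs (AddCommGroup (Loop n g × Ctr n × Der n))

instance : Module ℂ (FullToroidal n g κ a b) :=
  inferInstanceAs (Module ℂ (Loop n g × Ctr n × Der n))

/-- The component in `g ⊗ A_n`. -/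
def loop : FullToroidal n g κ a b →ₗ[ℂ] Loop n g := LinearMap.fst ℂ _ _

/-- The component in `Ω_{A_n} / dA_n`. -/
def ctr : FullToroidal n g κ a b →ₗ[ℂ] Ctr n := LinearMap.fst ℂ _ _ ∘ₗ LinearMap.snd ℂ _ _

/-- The component in `Der(A_n)`. -/
def der : FullToroidal n g κ a b →ₗ[ℂ] Der n := LinearMap.snd ℂ _ _ ∘ₗ LinearMap.snd ℂ _ _

/-- The element with the given components. -/
def mk (A : Loop n g) (z : Ctr n) (E : Der n) : FullToroidal n g κ a b := (A, z, E)

@[simp] theorem loop_mk (A : Loop n g) (z : Ctr n) (E : Der n) :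
    (mk A z E : FullToroidal n g κ a b).loop = A := rfl

@[simp] theorem ctr_mk (A : Loop n g) (z : Ctr n) (E : Der n) :
    (mk A z E : FullToroidal n g κ a b).ctr = z := rfl

@[simp] theorem der_mk (A : Loop n g) (z : Ctr n) (E : Der n) :
    (mk A z E : FullToroidal n g κ a b).der = E := rfl

@[ext] theorem ext {x y : FullToroidal n g κ a b} (h₁ : x.loop = y.loop) (h₂ : x.ctr = y.ctr)
    (h₃ : x.der = y.der) : x = y :=
  Prod.ext h₁ (Prod.ext h₂ h₃)

instance : Bracket (FullToroidal n g κ a b) (FullToroidal n g κ a b) where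
  bracket x y := mk
    (loopBr x.loop y.loop + derLoop x.der y.loop - derLoop y.der x.loop)
    (κ • loopCocycle x.loop y.loop + derCtr x.der y.ctr - derCtr y.der x.ctr
      + (a • phi₁ x.der y.der + b • phi₂ x.der y.der))
    (derBr x.der y.der)

theorem loop_lie (x y : FullToroidal n g κ a b) :
    ⁅x, y⁆.loop = loopBr x.loop y.loop + derLoop x.der y.loop - derLoop y.der x.loop := rfl

theorem ctr_lie (x y : FullToroidal n g κ a b) :
    ⁅x, y⁆.ctr = κ • loopCocycle x.loop y.loop + derCtr x.der y.ctr - derCtr y.der x.ctr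
      + (a • phi₁ x.der y.der + b • phi₂ x.der y.der) := rfl

theorem der_lie (x y : FullToroidal n g κ a b) : ⁅x, y⁆.der = derBr x.der y.der := rfl

instance : LieRing (FullToroidal n g κ a b) where
  add_lie x y z := by
    ext1 <;> simp only [loop_lie, ctr_lie, der_lie, map_add, LinearMap.add_apply, smul_add] <;> abel
  lie_add x y z := by
    ext1 <;> simp only [loop_lie, ctr_lie, der_lie, map_add, LinearMap.add_apply, smul_add] <;> abel
  lie_self x := by
    ext1 <;> simp [loop_lie, ctr_lie, der_lie, loopBr_self, loopCocycle_self, derBr_self,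
      phi₁_self, phi₂_self]
  leibniz_lie x y z := by
    ext1
    · have e := skew_of_self loopBr_self y.loop (derLoop z.der x.loop)
      have e1 := loop_jac x.loop y.loop z.loop
      have e2 := derBr_derLoop x.der y.der z.loop
      have e3 := derBr_derLoop x.der z.der y.loop
      have e4 := derBr_derLoop y.der z.der x.loop
      simp only [loop_lie, der_lie, map_add, map_sub, LinearMap.add_apply, LinearMap.sub_apply,
        derLoop_loopBr, e, e1, e2, e3, e4]
      abel
    · have e := skew_of_self loopCocycle_self y.loop (derLoop z.der x.loop)
      have e1 := loopCocycle_jac x.loop y.loop z.loop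
      have e2 := derBr_derCtr x.der y.der z.ctr
      have e3 := derBr_derCtr x.der z.der y.ctr
      have e4 := derBr_derCtr y.der z.der x.ctr
      have p1 := eq_sub_of_add_eq (phi₁_jac x.der y.der z.der)
      have p2 := eq_sub_of_add_eq (phi₂_jac x.der y.der z.der)
      simp only [loop_lie, ctr_lie, der_lie, map_add, map_sub, map_smul, LinearMap.add_apply,
        LinearMap.sub_apply, derCtr_loopCocycle, e, e1, e2, e3, e4, p1, p2]
      module
    · simp only [der_lie, map_add]
      exact der_jac _ _ _

instance : LieAlgebra ℂ (FullToroidal n g κ a b) where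
  lie_smul c x y := by
    ext1 <;> simp only [loop_lie, ctr_lie, der_lie, map_smul, LinearMap.smul_apply] <;> module

/-- `x(k) = x ⊗ t^k`. -/
def X (k : Lat n) (x : g) : FullToroidal n g κ a b := mk (Finsupp.single k x) 0 0

/-- The class of `∑ wᵢ t^r Kᵢ`. -/
def K (r : Lat n) (w : Fin n → ℂ) : FullToroidal n g κ a b := mk 0 (om r w) 0

/-- `D(u, r) = ∑ uᵢ t^r dᵢ`. -/
def D (u : Fin n → ℂ) (r : Lat n) : FullToroidal n g κ a b := mk 0 0 (Finsupp.single r u)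

theorem X_lie_X (p q : Lat n) (x y : g) :
    ⁅(X p x : FullToroidal n g κ a b), (X q y : FullToroidal n g κ a b)⁆ =
      X (p + q) ⁅x, y⁆ + (κ * killingForm ℂ g x y) • K (p + q) (toC p) := by
  ext1 <;> simp [loop_lie, ctr_lie, der_lie, X, K, mul_smul]

theorem D_lie_X (p q : Lat n) (u : Fin n → ℂ) (y : g) :
    ⁅(D u p : FullToroidal n g κ a b), (X q y : FullToroidal n g κ a b)⁆ =
      dot u (toC q) • X (p + q) y := by
  ext1 <;> simp [loop_lie, ctr_lie, der_lie, X, D]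

theorem K_lie_X (p q : Lat n) (w : Fin n → ℂ) (y : g) :
    ⁅(K p w : FullToroidal n g κ a b), (X q y : FullToroidal n g κ a b)⁆ = 0 := by
  ext1 <;> simp [loop_lie, ctr_lie, der_lie, X, K]

theorem K_lie_K (p q : Lat n) (w z : Fin n → ℂ) :
    ⁅(K p w : FullToroidal n g κ a b), (K q z : FullToroidal n g κ a b)⁆ = 0 := by
  ext1 <;> simp [loop_lie, ctr_lie, der_lie, K]

theorem D_lie_K (p q : Lat n) (u w : Fin n → ℂ) :
    ⁅(D u p : FullToroidal n g κ a b), (K q w : FullToroidal n g κ a b)⁆ =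
      dot u (toC q) • K (p + q) w + dot u w • K (p + q) (toC p) := by
  ext1 <;> simp [loop_lie, ctr_lie, der_lie, K, D]

theorem D_lie_D (p q : Lat n) (u v : Fin n → ℂ) :
    ⁅(D u p : FullToroidal n g κ a b), (D v q : FullToroidal n g κ a b)⁆ =
      D (dot u (toC q) • v - dot v (toC p) • u) (p + q)
        - (a * (dot u (toC q) * dot v (toC p)) + b * (dot u (toC p) * dot v (toC q)))
          • K (p + q) (toC p) := by
  ext1
  · simp [loop_lie, K, D]
  · simp only [ctr_lie, K, D, loop_mk, ctr_mk, der_mk, map_zero, phi₁_single,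
      phi₂_single, map_sub, map_smul]
    module
  · simp [der_lie, K, D]

end FullToroidal

end Full

/-! ## Subalgebras spanned by sets closed under the bracket -/

section OfSpan

variable {L : Type*} [LieRing L] [LieAlgebra ℂ L]

theorem lie_mem_of_span {S T : Set L} {N : Submodule ℂ L}
    (h : ∀ x ∈ S, ∀ y ∈ T, ⁅x, y⁆ ∈ N) {x y : L} (hx : x ∈ Submodule.span ℂ S)
    (hy : y ∈ Submodule.span ℂ T) : ⁅x, y⁆ ∈ N := by
  induction hx using Submodule.span_induction with
  | zero => simp
  | add x x' _ _ h h' => rw [add_lie]; exact N.add_mem h h'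
  | smul c x _ h => rw [smul_lie]; exact N.smul_mem c h
  | mem x hxS =>
    induction hy using Submodule.span_induction with
    | zero => simp
    | add x x' _ _ h h' => rw [lie_add]; exact N.add_mem h h'
    | smul c x _ h => rw [lie_smul]; exact N.smul_mem c h
    | mem y hyT => exact h x hxS y hyT

/-- The linear span of `S`, as a Lie subalgebra, when brackets of elements of `S` lie in it. -/
def spanSubalgebra (S : Set L) (h : ∀ x ∈ S, ∀ y ∈ S, ⁅x, y⁆ ∈ Submodule.span ℂ S) :
    LieSubalgebra ℂ L where
  __ := Submodule.span ℂ S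
  lie_mem' hx hy := lie_mem_of_span h hx hy

end OfSpan

/-! ## Multiloop algebras and Lie tori -/

/-- Commuting automorphisms `σ₁, …, σₙ` of `g` of finite orders `m₁, …, mₙ`, with chosen primitive
roots of unity `ζᵢ` of order `mᵢ`. -/
structure MultiloopData (n : ℕ) (g : Type*) [LieRing g] [LieAlgebra ℂ g] where
  σ : Fin n → (g ≃ₗ⁅ℂ⁆ g)
  comm : ∀ i j x, σ i (σ j x) = σ j (σ i x)
  m : Fin n → ℕ
  m_pos : ∀ i, 0 < m i
  order : ∀ i, orderOf (σ i).toLinearEquiv = m i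
  ζ : Fin n → ℂ
  primitive : ∀ i, IsPrimitiveRoot (ζ i) (m i)

/-- `Φ` is a root system of type `B_l` with respect to the linearly independent vectors `εᵢ`:
it consists of the vectors `± εᵢ` (the short roots) and `± εᵢ ± εⱼ` with `i ≠ j`.  For `l = 1`
this is type `B₁ = A₁`, in which all roots are short. -/
def IsTypeB {E : Type*} [AddCommGroup E] [Module ℂ E] (Φ : Set E) {l : ℕ} (ε : Fin l → E) : Prop :=
  LinearIndependent ℂ ε ∧
    Φ = {β | ∃ i, β = ε i ∨ β = - ε i} ∪
      {β | ∃ i j, i ≠ j ∧ (β = ε i + ε j ∨ β = ε i - ε j ∨ β = - ε i - ε j)}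

/-- The enlarged root system: `Φ ∪ 2 Φ_sh` if `Φ` is of type `B_l` for some `l ≥ 1`, and `Φ`
otherwise. -/
def enlarged {E : Type*} [AddCommGroup E] [Module ℂ E] (Φ : Set E) : Set E :=
  Φ ∪ {β | ∃ (l : ℕ) (ε : Fin l → E), IsTypeB Φ ε ∧ ∃ i, β = (2 : ℂ) • ε i ∨ β = -((2 : ℂ) • ε i)}

section ConditionM

variable {g₁ : Type*} [LieRing g₁] [LieAlgebra ℂ g₁] [FiniteDimensional ℂ g₁]
  [LieAlgebra.IsSimple ℂ g₁] (H : LieSubalgebra ℂ g₁) [H.IsCartanSubalgebra]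

/-- The root system `Δ₁^×` of `g₁` relative to `H`. -/
def roots : Set (Module.Dual ℂ H) := Set.range (LieAlgebra.IsKilling.rootSystem H).root

/-- Condition (M) on a `g₁`-module: it is finite-dimensional and irreducible of dimension greater
than one, and its nonzero weights relative to `H` lie in the enlarged root system of `g₁`. -/
def ConditionM (M : Type*) [AddCommGroup M] [Module ℂ M] [LieRingModule g₁ M] [LieModule ℂ g₁ M] :
    Prop :=
  FiniteDimensional ℂ M ∧ LieModule.IsIrreducible ℂ g₁ M ∧ 1 < Module.finrank ℂ M ∧
    ∀ χ : Module.Dual ℂ H, (∃ v : M, v ≠ 0 ∧ ∀ h : H, ⁅(h : g₁), v⁆ = χ h • v) →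
      χ = 0 ∨ χ ∈ enlarged (roots H)

variable {H} in
/-- `α` is positive with respect to the base `B` of the root system of `g₁`: it is a nonzero
combination of simple roots with coefficients in `ℕ`. -/
def IsPos (B : (LieAlgebra.IsKilling.rootSystem H).Base) (α : Module.Dual ℂ H) : Prop :=
  ∃ c : B.support → ℕ, c ≠ 0 ∧
    α = ∑ i, c i • (LieAlgebra.IsKilling.rootSystem H).root (i : LieSubalgebra.root)

variable {H} in
/-- `lam` is a dominant integral weight of `g₁`: its value on the coroot of every positive root is
a non-negative integer. -/
def IsDominantIntegral (B : (LieAlgebra.IsKilling.rootSystem H).Base) (lam : Module.Dual ℂ H) :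
    Prop :=
  ∀ i, IsPos B ((LieAlgebra.IsKilling.rootSystem H).root i) →
    ∃ N : ℕ, lam ((LieAlgebra.IsKilling.rootSystem H).coroot i) = (N : ℂ)

variable {H} {B : (LieAlgebra.IsKilling.rootSystem H).Base}

theorem IsPos.ne_zero {α : Module.Dual ℂ H} (h : IsPos B α) : α ≠ 0 := by
  rintro rfl
  obtain ⟨c, hc, h⟩ := h
  have hl : LinearIndependent ℂ fun i : B.support =>
      (LieAlgebra.IsKilling.rootSystem H).root (i : LieSubalgebra.root) := B.linearIndepOn_root
  apply hc
  funext i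
  have := Fintype.linearIndependent_iff.1 hl (fun i => (c i : ℂ))
    (by rw [h]; exact Finset.sum_congr rfl fun i _ => Nat.cast_smul_eq_nsmul ℂ _ _) i
  exact_mod_cast this

theorem IsPos.add {α β : Module.Dual ℂ H} (hα : IsPos B α) (hβ : IsPos B β) : IsPos B (α + β) := by
  obtain ⟨c, hc, rfl⟩ := hα
  obtain ⟨d, -, rfl⟩ := hβ
  refine ⟨c + d, ?_, ?_⟩
  · intro h
    apply hc
    funext i
    have := congrFun h i
    simp only [Pi.add_apply, Pi.zero_apply] at this ⊢
    omega
  · simp [add_smul, Finset.sum_add_distrib]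

end ConditionM

namespace MultiloopData

variable {n : ℕ} {g : Type*} [LieRing g] [LieAlgebra ℂ g] (D : MultiloopData n g)

/-- `r ∈ Γ = m₁ℤ ⊕ ⋯ ⊕ mₙℤ`. -/
def InΓ (r : Lat n) : Prop := ∀ i, (D.m i : ℤ) ∣ r i

/-- The simultaneous eigenspace `g(k̄) = {x | σᵢ x = ζᵢ^{kᵢ} x for all i}`. -/
def gr (k : Lat n) : Submodule ℂ g where
  carrier := {x | ∀ i, D.σ i x = (D.ζ i ^ k i) • x}
  add_mem' hx hy i := by simp [hx i, hy i]
  zero_mem' i := by simp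
  smul_mem' c x hx i := by rw [map_smul, hx i, smul_comm]

/-- The subalgebra `g(0̄)` of common fixed points. -/
def fixed : LieSubalgebra ℂ g where
  carrier := {x | ∀ i, D.σ i x = x}
  add_mem' hx hy i := by simp [hx i, hy i]
  zero_mem' i := by simp
  smul_mem' c x hx i := by simp [hx i]
  lie_mem' hx hy i := by rw [LieEquiv.map_lie, hx i, hy i]

theorem fixed_mem_gr (x : D.fixed) : (x : g) ∈ D.gr 0 := fun i => by
  simpa using x.2 i

variable {D} in
theorem ζ_ne (i : Fin n) : D.ζ i ≠ 0 := (D.primitive i).ne_zero (D.m_pos i).ne'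

variable {D} in
theorem gr_lie {k l : Lat n} {x y : g} (hx : x ∈ D.gr k) (hy : y ∈ D.gr l) :
    ⁅x, y⁆ ∈ D.gr (k + l) := fun i => by
  rw [LieEquiv.map_lie, hx i, hy i, Pi.add_apply, zpow_add₀ (ζ_ne i), smul_lie, lie_smul, smul_smul]

variable {D} in
theorem gr_add_of_inΓ {r k : Lat n} (hr : D.InΓ r) {x : g} (hx : x ∈ D.gr k) :
    x ∈ D.gr (r + k) := fun i => by
  rw [hx i, Pi.add_apply, zpow_add₀ (ζ_ne i),
    ((D.primitive i).zpow_eq_one_iff_dvd _).2 (hr i), one_mul]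

variable {D} in
theorem inΓ_of_killing_ne {k l : Lat n} {x y : g} (hx : x ∈ D.gr k) (hy : y ∈ D.gr l)
    (h : killingForm ℂ g x y ≠ 0) : D.InΓ (k + l) := fun i => by
  have e := LieAlgebra.killingForm_of_equiv_apply (R := ℂ) (D.σ i) x y
  rw [hx i, hy i, map_smul, map_smul, LinearMap.smul_apply, smul_smul, smul_eq_mul,
    mul_comm, mul_eq_left₀ h, mul_comm, ← zpow_add₀ (ζ_ne i)] at e
  exact ((D.primitive i).zpow_eq_one_iff_dvd _).1 (by simpa [add_comm] using e)

variable {D} in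
theorem InΓ.add {r s : Lat n} (hr : D.InΓ r) (hs : D.InΓ s) : D.InΓ (r + s) :=
  fun i => dvd_add (hr i) (hs i)

theorem inΓ_zero : D.InΓ 0 := fun _ => dvd_zero _

/-- The multiloop algebra `⊕ g(k̄) ⊗ t^k` is a Lie torus: besides the simplicity of `g(0̄)`, which
is the instance argument, (2) every nonzero `g(k̄)` with `k̄ ≠ 0̄` is, as a `g(0̄)`-module, the direct
sum of a trivial module `U` and a module `W` which is zero or satisfies condition (M), and (3) the
group generated by the `σᵢ` has order `∏ mᵢ`.  Here `H` is a Cartan subalgebra of `g(0̄)`. -/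
structure IsLieTorus [FiniteDimensional ℂ g] [LieAlgebra.IsSimple ℂ D.fixed]
    (H : LieSubalgebra ℂ D.fixed) [H.IsCartanSubalgebra] : Prop where
  decomp : ∀ k : Lat n, ¬ D.InΓ k → D.gr k ≠ ⊥ →
    ∃ U W : LieSubmodule ℂ D.fixed g,
      (U : Submodule ℂ g) ⊔ (W : Submodule ℂ g) = D.gr k ∧
      Disjoint (U : Submodule ℂ g) (W : Submodule ℂ g) ∧
      (∀ (x : D.fixed), ∀ u ∈ U, ⁅x, u⁆ = 0) ∧
      (W = ⊥ ∨ ConditionM H W)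
  card : Nat.card (Subgroup.closure (Set.range fun i => (D.σ i).toLinearEquiv)) = ∏ i, D.m i

/-! ## The twisted toroidal extended affine Lie algebra -/

section Tau

variable (κ a b : ℂ)

/-- Spanning set of `LT ⊕ Ω_{A_n(m)} / dA_n(m) ⊕ S_n(m)`, where `A_n(m)` is the ring of Laurent
polynomials with exponents in `Γ`. -/
def tauGen : Set (FullToroidal n g κ a b) :=
  {y | ∃ k x, x ∈ D.gr k ∧ y = FullToroidal.X k x} ∪
  {y | ∃ r w, D.InΓ r ∧ y = FullToroidal.K r w} ∪
  {y | ∃ u r, D.InΓ r ∧ dot u (toC r) = 0 ∧ y = FullToroidal.D u r}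

variable {D κ a b} in
theorem X_mem {k : Lat n} {x : g} (hx : x ∈ D.gr k) :
    FullToroidal.X k x ∈ Submodule.span ℂ (D.tauGen κ a b) :=
  Submodule.subset_span (Or.inl (Or.inl ⟨k, x, hx, rfl⟩))

variable {D κ a b} in
theorem K_mem {r : Lat n} (hr : D.InΓ r) (w : Fin n → ℂ) :
    FullToroidal.K r w ∈ Submodule.span ℂ (D.tauGen κ a b) :=
  Submodule.subset_span (Or.inl (Or.inr ⟨r, w, hr, rfl⟩))

variable {D κ a b} in
theorem D_mem {r : Lat n} (hr : D.InΓ r) {u : Fin n → ℂ} (hu : dot u (toC r) = 0) :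
    FullToroidal.D u r ∈ Submodule.span ℂ (D.tauGen κ a b) :=
  Submodule.subset_span (Or.inr ⟨u, r, hr, hu, rfl⟩)

theorem tauGen_lie : ∀ x ∈ D.tauGen κ a b, ∀ y ∈ D.tauGen κ a b,
    ⁅x, y⁆ ∈ Submodule.span ℂ (D.tauGen κ a b) := by
  have DX : ∀ u r, D.InΓ r → ∀ k x, x ∈ D.gr k →
      ⁅(FullToroidal.D u r : FullToroidal n g κ a b), FullToroidal.X k x⁆ ∈
        Submodule.span ℂ (D.tauGen κ a b) := by
    intro u r hr k x hx
    rw [FullToroidal.D_lie_X]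
    exact Submodule.smul_mem _ _ (X_mem (gr_add_of_inΓ hr hx))
  have DK : ∀ u r, D.InΓ r → ∀ q w, D.InΓ q →
      ⁅(FullToroidal.D u r : FullToroidal n g κ a b), FullToroidal.K q w⁆ ∈
        Submodule.span ℂ (D.tauGen κ a b) := by
    intro u r hr q w hq
    rw [FullToroidal.D_lie_K]
    exact add_mem (Submodule.smul_mem _ _ (K_mem (hr.add hq) _))
      (Submodule.smul_mem _ _ (K_mem (hr.add hq) _))
  rintro _ ((⟨k, x, hx, rfl⟩ | ⟨r, w, hr, rfl⟩) | ⟨u, r, hr, hu, rfl⟩) _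
    ((⟨l, y, hy, rfl⟩ | ⟨s, z, hs, rfl⟩) | ⟨v, s, hs, hv, rfl⟩)
  · rw [FullToroidal.X_lie_X]
    refine add_mem (X_mem (gr_lie hx hy)) ?_
    by_cases h : killingForm ℂ g x y = 0
    · simp [h]
    · exact Submodule.smul_mem _ _ (K_mem (inΓ_of_killing_ne hx hy h) _)
  · rw [← lie_skew, FullToroidal.K_lie_X]; simp
  · rw [← lie_skew]; exact neg_mem (DX v s hs k x hx)
  · rw [FullToroidal.K_lie_X]; simp
  · rw [FullToroidal.K_lie_K]; simp
  · rw [← lie_skew]; exact neg_mem (DK v s hs r w hr)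
  · exact DX u r hr l y hy
  · exact DK u r hr s z hs
  · rw [FullToroidal.D_lie_D]
    refine sub_mem (D_mem (hr.add hs) ?_) (Submodule.smul_mem _ _ (K_mem (hr.add hs) _))
    simp only [toC_add, dot_add, sub_dot, smul_dot, hu, hv]
    ring

/-- The twisted toroidal extended affine Lie algebra
`τ = LT ⊕ Ω_{A_n(m)} / dA_n(m) ⊕ S_n(m)`. -/
def tau : LieSubalgebra ℂ (FullToroidal n g κ a b) :=
  spanSubalgebra (D.tauGen κ a b) (D.tauGen_lie κ a b)

variable {D κ a b}

/-- `x ⊗ t^k ∈ τ` for `x ∈ g(k̄)`. -/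
def tX (k : Lat n) (x : D.gr k) : D.tau κ a b := ⟨FullToroidal.X k x, X_mem x.2⟩

/-- The degree zero central element `∑ wᵢ Kᵢ ∈ τ`. -/
def tK (w : Fin n → ℂ) : D.tau κ a b := ⟨FullToroidal.K 0 w, K_mem D.inΓ_zero w⟩

/-- The degree derivation `∑ uᵢ dᵢ ∈ τ`. -/
def tD (u : Fin n → ℂ) : D.tau κ a b := ⟨FullToroidal.D u 0, D_mem D.inΓ_zero (by simp)⟩

end Tau

/-! ## Root spaces, triangular decomposition, weights and integrability -/

section Triangular

variable (H : LieSubalgebra ℂ D.fixed)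

/-- `g(k̄, α) = {x ∈ g(k̄) | [h, x] = α(h) x for all h ∈ h(0̄)}`. -/
def rootSp (k : Lat n) (α : Module.Dual ℂ H) : Submodule ℂ g where
  carrier := {x | x ∈ D.gr k ∧ ∀ h : H, ⁅((h : D.fixed) : g), x⁆ = α h • x}
  add_mem' hx hy := ⟨add_mem hx.1 hy.1, fun h => by rw [lie_add, hx.2, hy.2, smul_add]⟩
  zero_mem' := ⟨zero_mem _, fun h => by simp⟩
  smul_mem' c x hx := ⟨Submodule.smul_mem _ c hx.1, fun h => by
    rw [lie_smul, hx.2, smul_comm]⟩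

variable {D H}

theorem rootSp_lie {k l : Lat n} {α β : Module.Dual ℂ H} {x y : g} (hx : x ∈ D.rootSp H k α)
    (hy : y ∈ D.rootSp H l β) : ⁅x, y⁆ ∈ D.rootSp H (k + l) (α + β) :=
  ⟨gr_lie hx.1 hy.1, fun h => by
    rw [leibniz_lie, hx.2, hy.2, smul_lie, lie_smul, ← add_smul, LinearMap.add_apply]⟩

theorem killing_eq_zero {k l : Lat n} {α β : Module.Dual ℂ H} {x y : g} (hx : x ∈ D.rootSp H k α)
    (hy : y ∈ D.rootSp H l β) (h : α + β ≠ 0) : killingForm ℂ g x y = 0 := by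
  by_contra hne
  apply h
  ext t
  have e := LieModule.traceForm_apply_lie_apply ℂ g g x ((t : D.fixed) : g) y
  rw [hy.2 t, ← lie_skew, hx.2 t] at e
  simp only [map_neg, map_smul, LinearMap.neg_apply, LinearMap.smul_apply, smul_eq_mul] at e
  have : (α t + β t) * killingForm ℂ g x y = 0 := by
    linear_combination -e
  simpa [hne] using this

variable {κ a b : ℂ}

theorem tX_lie_tX {k l : Lat n} {α β : Module.Dual ℂ H} {x : D.gr k} {y : D.gr l}
    (hx : (x : g) ∈ D.rootSp H k α) (hy : (y : g) ∈ D.rootSp H l β) (h : α + β ≠ 0) :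
    ⁅(tX k x : D.tau κ a b), (tX l y : D.tau κ a b)⁆ =
      tX (k + l) ⟨⁅(x : g), (y : g)⁆, (rootSp_lie hx hy).1⟩ := by
  apply Subtype.ext
  simp [tX, FullToroidal.X_lie_X, killing_eq_zero hx hy h]

variable (D H κ a b) in
/-- The elements `x ⊗ t^k` of `τ` with `x ∈ g(k̄, α)` for some `α` satisfying `S`. -/
def partGen (S : Module.Dual ℂ H → Prop) : Set (D.tau κ a b) :=
  {y | ∃ α k, ∃ x : D.gr k, S α ∧ (x : g) ∈ D.rootSp H k α ∧ y = tX k x}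

theorem partGen_lie {S : Module.Dual ℂ H → Prop} (hS : ∀ α β, S α → S β → S (α + β))
    (hS0 : ¬ S 0) : ∀ x ∈ D.partGen H κ a b S, ∀ y ∈ D.partGen H κ a b S,
      ⁅x, y⁆ ∈ Submodule.span ℂ (D.partGen H κ a b S) := by
  rintro _ ⟨α, k, x, hα, hx, rfl⟩ _ ⟨β, l, y, hβ, hy, rfl⟩
  rw [tX_lie_tX hx hy (fun h => hS0 (h ▸ hS α β hα hβ))]
  exact Submodule.subset_span ⟨α + β, k + l, _, hS α β hα hβ, rootSp_lie hx hy, rfl⟩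

variable (D H κ a b) in
/-- Spanning set of `τ⁰`. -/
def zeroGen : Set (D.tau κ a b) :=
  D.partGen H κ a b (fun α => α = 0) ∪
  {y | ∃ r w, D.InΓ r ∧ (y : FullToroidal n g κ a b) = FullToroidal.K r w} ∪
  {y | ∃ u r, D.InΓ r ∧ dot u (toC r) = 0 ∧ (y : FullToroidal n g κ a b) = FullToroidal.D u r}

theorem zero_part_lie {S : Module.Dual ℂ H → Prop} (hS0 : ¬ S 0) :
    ∀ y ∈ D.zeroGen H κ a b, ∀ x ∈ D.partGen H κ a b S,
      ⁅y, x⁆ ∈ Submodule.span ℂ (D.partGen H κ a b S) := by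
  rintro y ((⟨_, l, z, rfl, hz, rfl⟩ | ⟨r, w, hr, hy⟩) | ⟨u, r, hr, hu, hy⟩) _
    ⟨α, k, x, hα, hx, rfl⟩
  · rw [tX_lie_tX hz hx (fun h => hS0 (by rw [zero_add] at h; exact h ▸ hα))]
    exact Submodule.subset_span ⟨α, l + k, _, hα, by simpa using rootSp_lie hz hx, rfl⟩
  · have : ⁅y, (tX k x : D.tau κ a b)⁆ = 0 := by
      apply Subtype.ext
      simp [tX, hy, FullToroidal.K_lie_X]
    simp [this]
  · have : ⁅y, (tX k x : D.tau κ a b)⁆ =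
        dot u (toC k) • tX (r + k) ⟨(x : g), gr_add_of_inΓ hr x.2⟩ := by
      apply Subtype.ext
      simp [tX, hy, FullToroidal.D_lie_X]
    rw [this]
    exact Submodule.smul_mem _ _ (Submodule.subset_span
      ⟨α, r + k, _, hα, ⟨gr_add_of_inΓ hr x.2, hx.2⟩, rfl⟩)

theorem zeroGen_lie : ∀ x ∈ D.zeroGen H κ a b, ∀ y ∈ D.zeroGen H κ a b,
    ⁅x, y⁆ ∈ Submodule.span ℂ (D.zeroGen H κ a b) := by
  have KM : ∀ r w, D.InΓ r → ∀ y : D.tau κ a b,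
      (y : FullToroidal n g κ a b) = FullToroidal.K r w →
      y ∈ Submodule.span ℂ (D.zeroGen H κ a b) := fun r w hr y hy =>
    Submodule.subset_span (Or.inl (Or.inr ⟨r, w, hr, hy⟩))
  have DM : ∀ u r, D.InΓ r → dot u (toC r) = 0 → ∀ y : D.tau κ a b,
      (y : FullToroidal n g κ a b) = FullToroidal.D u r →
      y ∈ Submodule.span ℂ (D.zeroGen H κ a b) := fun u r hr hu y hy =>
    Submodule.subset_span (Or.inr ⟨u, r, hr, hu, hy⟩)
  have DX : ∀ u r, D.InΓ r → ∀ y : D.tau κ a b,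
      (y : FullToroidal n g κ a b) = FullToroidal.D u r → ∀ k, ∀ x : D.gr k,
      (x : g) ∈ D.rootSp H k 0 →
      ⁅y, (tX k x : D.tau κ a b)⁆ ∈ Submodule.span ℂ (D.zeroGen H κ a b) := by
    intro u r hr y hy k x hx
    have : ⁅y, (tX k x : D.tau κ a b)⁆ =
        dot u (toC k) • tX (r + k) ⟨(x : g), gr_add_of_inΓ hr x.2⟩ := by
      apply Subtype.ext
      simp [tX, hy, FullToroidal.D_lie_X]
    rw [this]
    exact Submodule.smul_mem _ _ (Submodule.subset_span (Or.inl (Or.inl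
      ⟨0, r + k, _, rfl, ⟨gr_add_of_inΓ hr x.2, hx.2⟩, rfl⟩)))
  have DK : ∀ u r, D.InΓ r → ∀ y : D.tau κ a b,
      (y : FullToroidal n g κ a b) = FullToroidal.D u r → ∀ q w, D.InΓ q → ∀ z : D.tau κ a b,
      (z : FullToroidal n g κ a b) = FullToroidal.K q w →
      ⁅y, z⁆ ∈ Submodule.span ℂ (D.zeroGen H κ a b) := by
    intro u r hr y hy q w hq z hz
    have : ⁅y, z⁆ = dot u (toC q) • (⟨_, K_mem (hr.add hq) w⟩ : D.tau κ a b) +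
        dot u w • (⟨_, K_mem (hr.add hq) (toC r)⟩ : D.tau κ a b) := by
      apply Subtype.ext
      simp [hy, hz, FullToroidal.D_lie_K]
    rw [this]
    exact add_mem (Submodule.smul_mem _ _ (KM _ _ (hr.add hq) _ rfl))
      (Submodule.smul_mem _ _ (KM _ _ (hr.add hq) _ rfl))
  rintro y ((⟨_, k, x, rfl, hx, rfl⟩ | ⟨r, w, hr, hy⟩) | ⟨u, r, hr, hu, hy⟩) z
    ((⟨_, l, x', rfl, hx', rfl⟩ | ⟨s, w', hs, hz⟩) | ⟨v, s, hs, hv, hz⟩)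
  · by_cases h : killingForm ℂ g (x : g) (x' : g) = 0
    · have : ⁅(tX k x : D.tau κ a b), (tX l x' : D.tau κ a b)⁆ =
          tX (k + l) ⟨⁅(x : g), (x' : g)⁆, (rootSp_lie hx hx').1⟩ := by
        apply Subtype.ext
        simp [tX, FullToroidal.X_lie_X, h]
      rw [this]
      exact Submodule.subset_span (Or.inl (Or.inl
        ⟨0, k + l, _, rfl, by simpa using rootSp_lie hx hx', rfl⟩))
    · have hr := inΓ_of_killing_ne x.2 x'.2 h
      have : ⁅(tX k x : D.tau κ a b), (tX l x' : D.tau κ a b)⁆ =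
          tX (k + l) ⟨⁅(x : g), (x' : g)⁆, (rootSp_lie hx hx').1⟩ +
          (κ * killingForm ℂ g (x : g) (x' : g)) •
            (⟨_, K_mem hr (toC k)⟩ : D.tau κ a b) := by
        apply Subtype.ext
        simp [tX, FullToroidal.X_lie_X]
      rw [this]
      exact add_mem (Submodule.subset_span (Or.inl (Or.inl
        ⟨0, k + l, _, rfl, by simpa using rootSp_lie hx hx', rfl⟩)))
        (Submodule.smul_mem _ _ (KM _ _ hr _ rfl))
  · have : ⁅z, (tX k x : D.tau κ a b)⁆ = 0 := by
      apply Subtype.ext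
      simp [tX, hz, FullToroidal.K_lie_X]
    rw [← lie_skew, this]; simp
  · rw [← lie_skew]; exact neg_mem (DX v s hs z hz k x hx)
  · have : ⁅y, (tX l x' : D.tau κ a b)⁆ = 0 := by
      apply Subtype.ext
      simp [tX, hy, FullToroidal.K_lie_X]
    rw [this]; simp
  · have : ⁅y, z⁆ = 0 := by
      apply Subtype.ext
      simp [hy, hz, FullToroidal.K_lie_K]
    rw [this]; simp
  · rw [← lie_skew]; exact neg_mem (DK v s hs z hz r w hr y hy)
  · exact DX u r hr y hy l x' hx'
  · exact DK u r hr y hy s w' hs z hz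
  · have h0 : dot (dot u (toC s) • v - dot v (toC r) • u) (toC (r + s)) = 0 := by
      simp only [toC_add, dot_add, sub_dot, smul_dot, hu, hv]
      ring
    have : ⁅y, z⁆ = (⟨_, D_mem (hr.add hs) h0⟩ : D.tau κ a b) -
        (a * (dot u (toC s) * dot v (toC r)) + b * (dot u (toC r) * dot v (toC s))) •
          (⟨_, K_mem (hr.add hs) (toC r)⟩ : D.tau κ a b) := by
      apply Subtype.ext
      simp [hy, hz, FullToroidal.D_lie_D]
    rw [this]
    exact sub_mem (DM _ _ (hr.add hs) h0 _ rfl) (Submodule.smul_mem _ _ (KM _ _ (hr.add hs) _ rfl))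

variable (D H κ a b) in
/-- `τ⁰ = ⊕ g(k̄, 0) ⊗ t^k ⊕ Ω_{A_n(m)} / dA_n(m) ⊕ S_n(m)`. -/
def tauZero : LieSubalgebra ℂ (D.tau κ a b) := spanSubalgebra (D.zeroGen H κ a b) zeroGen_lie

/-- The Cartan subalgebra `h(0̄) ⊕ ∑ ℂ Kᵢ ⊕ ∑ ℂ dᵢ` of `τ`, in coordinates `(h, c, u)`. -/
abbrev Cartan (H : LieSubalgebra ℂ D.fixed) : Type _ := H × (Fin n → ℂ) × (Fin n → ℂ)

/-- The element `h ⊗ 1 + ∑ cᵢ Kᵢ + ∑ uᵢ dᵢ` of `τ`. -/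
def cartanElt (t : Cartan H) : D.tau κ a b :=
  tX 0 ⟨((t.1 : D.fixed) : g), D.fixed_mem_gr _⟩ + tK t.2.1 + tD t.2.2

variable (H) in
/-- `δ_β = ∑ βᵢ δᵢ`, the functional with `δ_β(dᵢ) = βᵢ` vanishing on `h(0̄)` and on the `Kᵢ`. -/
def delta (β : Fin n → ℂ) : Module.Dual ℂ (Cartan H) :=
  (dotProductBilin ℂ ℂ β : (Fin n → ℂ) →ₗ[ℂ] ℂ) ∘ₗ LinearMap.snd ℂ _ _ ∘ₗ LinearMap.snd ℂ _ _

/-- The extension of `lam ∈ h(0̄)*` which vanishes on the `Kᵢ` and the `dᵢ`. -/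
def extend (lam : Module.Dual ℂ H) : Module.Dual ℂ (Cartan H) := lam ∘ₗ LinearMap.fst ℂ _ _

/-- `U(S) N`, the span of the vectors `u v` with `u` in the universal enveloping algebra of the
subalgebra `S` of `τ` and `v ∈ N`. -/
def envSpan {κ a b : ℂ} (V : Type*) [AddCommGroup V] [Module ℂ V] [LieRingModule (D.tau κ a b) V]
    [LieModule ℂ (D.tau κ a b) V] (S : LieSubalgebra ℂ (D.tau κ a b)) (N : Submodule ℂ V) : Submodule ℂ V :=
  Submodule.span ℂ {w | ∃ u : UniversalEnvelopingAlgebra ℂ S, ∃ v ∈ N,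
    w = UniversalEnvelopingAlgebra.lift ℂ (LieModule.toEnd ℂ S V) u v}

section Module

variable (κ a b) (V : Type*) [AddCommGroup V] [Module ℂ V] [LieRingModule (D.tau κ a b) V]
  [LieModule ℂ (D.tau κ a b) V]

/-- The weight space `V_μ`. -/
def weightSp (μ : Module.Dual ℂ (Cartan H)) : Submodule ℂ V where
  carrier := {v | ∀ t : Cartan H, ⁅(cartanElt t : D.tau κ a b), v⁆ = μ t • v}
  add_mem' hx hy t := by rw [lie_add, hx t, hy t, smul_add]
  zero_mem' t := by simp
  smul_mem' c x hx t := by rw [lie_smul, hx t, smul_comm]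

variable (H)

/-- Integrable modules: the sum of the weight spaces (which is always direct) is the whole space,
the weight spaces are finite-dimensional, and the real root vectors act locally nilpotently. -/
structure IsIntegrable [FiniteDimensional ℂ g] [LieAlgebra.IsSimple ℂ D.fixed] [H.IsCartanSubalgebra] : Prop where
  iSup_weightSp : ⨆ μ : Module.Dual ℂ (Cartan H), weightSp κ a b V μ = ⊤
  finite : ∀ μ : Module.Dual ℂ (Cartan H), FiniteDimensional ℂ (weightSp κ a b V μ)
  nilpotent : ∀ (k : Lat n) (α : Module.Dual ℂ H), α ≠ 0 → α ∈ enlarged (roots H) →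
    ∀ x : D.gr k, (x : g) ∈ D.rootSp H k α →
      ∀ v : V, ∃ N : ℕ, ((LieModule.toEnd ℂ (D.tau κ a b) V (tX k x)) ^ N) v = 0

variable {H} [FiniteDimensional ℂ g] [LieAlgebra.IsSimple ℂ D.fixed] [H.IsCartanSubalgebra]
  (B : (LieAlgebra.IsKilling.rootSystem H).Base)

/-- `τ⁺ = ⊕_{α > 0} g(k̄, α) ⊗ t^k`. -/
def tauPos : LieSubalgebra ℂ (D.tau κ a b) :=
  spanSubalgebra (D.partGen H κ a b (IsPos B))
    (partGen_lie (fun _ _ h h' => h.add h') fun h => h.ne_zero rfl)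

/-- `τ⁻ = ⊕_{α < 0} g(k̄, α) ⊗ t^k`. -/
def tauNeg : LieSubalgebra ℂ (D.tau κ a b) :=
  spanSubalgebra (D.partGen H κ a b (fun α => IsPos B (-α)))
    (partGen_lie (fun _ _ h h' => by rw [neg_add]; exact h.add h')
      fun h => h.ne_zero neg_zero)

/-- The highest weight space `V₊ = {v | τ⁺ v = 0}`, a `τ⁰`-submodule of `V`. -/
def Vplus : LieSubmodule ℂ (D.tauZero H κ a b) V where
  carrier := {v | ∀ x ∈ tauPos κ a b B, ⁅x, v⁆ = 0}
  add_mem' hx hy t ht := by rw [lie_add, hx t ht, hy t ht, add_zero]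
  zero_mem' t _ := by simp
  smul_mem' c x hx t ht := by rw [lie_smul, hx t ht, smul_zero]
  lie_mem {y v} hv x hx := by
    have h : ⁅(y : D.tau κ a b), x⁆ ∈ tauPos κ a b B :=
      lie_mem_of_span (zero_part_lie fun h => h.ne_zero rfl) y.2 hx
    have e := leibniz_lie (y : D.tau κ a b) x v
    rw [hv x hx, hv _ h, lie_zero, zero_add] at e
    exact e.symm

/-- For some `β ∈ ℂⁿ`, all weights of `V₊` have the form `lam + δ_{r + β}` with `r ∈ ℤⁿ`. -/
def WeightsOfForm (lam : Module.Dual ℂ H) : Prop :=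
  ∃ β : Fin n → ℂ, ∀ μ : Module.Dual ℂ (Cartan H),
    (∃ v ∈ Vplus κ a b V B, v ≠ 0 ∧ v ∈ weightSp κ a b V μ) →
      ∃ r : Lat n, μ = extend lam + delta H (toC r + β)

end Module

end Triangular

end MultiloopData

end ToroidalEALA

end

/-!
Let `λ` run over the weights of `h(0̄)` and `t` over `ℤⁿ`, and let `A t` be the set of those `λ`
which occur in `V` in degree `t + β`, for a fixed `β ∈ ℂⁿ`. The point is to find a weight `λ` in
some `A t` such that no `λ + α` with `α > 0` a weight of `τ` lies in any `A t'`.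

Since the central elements `Kᵢ` act by zero, for a root `α` of `g(0̄)` and `l ∈ Γ` the elements
`e_α ⊗ t^l` and `f_α ⊗ t^{-l}` act on `V` as a locally nilpotent `sl₂`-triple whose Cartan element
is the coroot of `α` (`exists_nilpSl2`). This has three consequences. Each `A t` is saturated
(`isSaturated_wtSet`). As weight spaces are finite-dimensional, no `A t` contains a ray `λ + ℕ α`
(`not_ray_wtSet`). And if `λ ∈ A t` is positive on the coroot of `α`, then `λ - α ∈ A (t - l)` for
every `l ∈ Γ` (`exists_int_of_mem_wtSet`), so that `λ - α` occurs in one of the finitely many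
degrees representing `ℤⁿ / Γ`.

The rest of the existence proof is combinatorics of root systems (`exists_highest`). If no highest
`λ` exists, then above every dominant weight that occurs there is a higher one, and all of them
occur in the representative degrees. So a single `A t` contains dominant weights `x + ∑ kᵢ αᵢ` with
`∑ kᵢ` unbounded. By connectedness of the Dynkin diagram all `kᵢ` are then unbounded
(`exists_forall_le_of_dominant`), so these weights exceed every `x + j θ`, for a dominant root `θ`,
and by saturation the whole ray `x + ℕ θ` lies in `A t` (`IsSaturated.exists_ray`), which is
impossible. The Lie torus axioms enter through the fact that the nonzero weights of `τ` are roots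
or doubles of roots (`mem_enlarged_of_mem_rootSp`), which gives `τ = τ⁻ + τ⁰ + τ⁺`.

Given a highest `λ`, any nonzero `τ⁰`-stable `N ⊆ V₊` satisfies `U(τ⁻) N = V` (`envSpan_eq_top`).
Comparing `h(0̄)`-eigenvalues shows that `V₊` is the full eigenspace of `λ` and that it has no
proper nonzero `τ⁰`-submodules (`eq_hWtSp_of_stable`, `Vplus_eq_hWtSp`).
-/

open scoped BigOperators

noncomputable section

namespace ToroidalEALA

/-! ### Locally nilpotent `sl₂`-triples of operators -/

section Sl2

variable {V : Type*} [AddCommGroup V] [Module ℂ V]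

/-- Operators `e`, `f`, `h` satisfying the relations of `sl₂`, with `e` and `f` locally nilpotent.
In contrast to `IsSl2Triple`, all three may vanish. -/
structure NilpSl2 (e f h : Module.End ℂ V) : Prop where
  ef : ∀ v, e (f v) = f (e v) + h v
  he : ∀ v, h (e v) = e (h v) + (2 : ℂ) • e v
  hf : ∀ v, h (f v) = f (h v) - (2 : ℂ) • f v
  nilp_e : ∀ v, ∃ N : ℕ, (e ^ N) v = 0
  nilp_f : ∀ v, ∃ N : ℕ, (f ^ N) v = 0

namespace NilpSl2

variable {e f h : Module.End ℂ V}

theorem h_pow_f (t : NilpSl2 e f h) {v : V} {c : ℂ} (hv : h v = c • v) (j : ℕ) :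
    h ((f ^ j) v) = (c - 2 * j) • (f ^ j) v := by
  induction j with
  | zero => simpa using hv
  | succ j ih =>
    rw [pow_succ', Module.End.mul_apply, t.hf, ih, map_smul]
    push_cast
    module

theorem h_pow_e (t : NilpSl2 e f h) {v : V} {c : ℂ} (hv : h v = c • v) (j : ℕ) :
    h ((e ^ j) v) = (c + 2 * j) • (e ^ j) v := by
  induction j with
  | zero => simpa using hv
  | succ j ih =>
    rw [pow_succ', Module.End.mul_apply, t.he, ih, map_smul]
    push_cast
    module

theorem e_pow_succ_f (t : NilpSl2 e f h) {v : V} {c : ℂ} (hv : h v = c • v) (j : ℕ) :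
    e ((f ^ (j + 1)) v) = (f ^ (j + 1)) (e v) + ((j + 1) * (c - j)) • (f ^ j) v := by
  induction j with
  | zero => simp [t.ef, hv]
  | succ j ih =>
    rw [pow_succ', Module.End.mul_apply, t.ef, ih, t.h_pow_f hv, map_add, map_smul,
      ← Module.End.mul_apply f (f ^ (j + 1)), ← Module.End.mul_apply f (f ^ j), ← pow_succ',
      ← pow_succ']
    push_cast
    module

/-- The last nonzero vector of the sequence `v, e v, e² v, …` is a highest weight vector. -/
theorem exists_primitive (t : NilpSl2 e f h) {v : V} (hv : v ≠ 0) :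
    ∃ k : ℕ, (e ^ k) v ≠ 0 ∧ e ((e ^ k) v) = 0 := by
  obtain ⟨k, h1, h2⟩ := Nat.exists_not_and_succ_of_not_zero_of_exists
    (p := fun k => (e ^ k) v = 0) (by simpa using hv) (t.nilp_e v)
  exact ⟨k, h1, by rwa [pow_succ', Module.End.mul_apply] at h2⟩

theorem primitive_nat (t : NilpSl2 e f h) {v : V} {c : ℂ} (h0 : v ≠ 0) (hv : h v = c • v)
    (he : e v = 0) : ∃ N : ℕ, c = N := by
  obtain ⟨k, h1, h2⟩ := Nat.exists_not_and_succ_of_not_zero_of_exists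
    (p := fun k => (f ^ k) v = 0) (by simpa using h0) (t.nilp_f v)
  have h3 := t.e_pow_succ_f hv k
  rw [h2, he, map_zero, map_zero, zero_add] at h3
  have h4 : ((k : ℂ) + 1) * (c - k) = 0 := (smul_eq_zero.1 h3.symm).resolve_right h1
  rcases mul_eq_zero.1 h4 with h5 | h5
  · exact absurd h5 (Nat.cast_add_one_ne_zero k)
  · exact ⟨k, sub_eq_zero.1 h5⟩

theorem weight_int (t : NilpSl2 e f h) {v : V} {c : ℂ} (h0 : v ≠ 0) (hv : h v = c • v) :
    ∃ z : ℤ, c = z := by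
  obtain ⟨k, h1, h2⟩ := t.exists_primitive h0
  obtain ⟨N, hN⟩ := t.primitive_nat h1 (t.h_pow_e hv k) h2
  exact ⟨(N : ℤ) - 2 * k, by push_cast; linear_combination hN⟩

/-- `f ^ j` is injective on the weight space of weight `c` as long as `j ≤ c`. -/
theorem pow_f_ne_zero (t : NilpSl2 e f h) {v : V} {c : ℕ} (h0 : v ≠ 0) (hv : h v = (c : ℂ) • v)
    {j : ℕ} (hj : j ≤ c) : (f ^ j) v ≠ 0 := by
  obtain ⟨k, hk⟩ := t.nilp_e v
  intro hf
  apply h0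
  clear h0
  induction k generalizing v c j with
  | zero => simpa using hk
  | succ k ih =>
    have hev : e v = 0 := by
      refine ih (c := c + 2) (j := j + 1) ?_ (by omega) (by rwa [pow_succ] at hk) ?_
      · rw [t.he, hv, map_smul]; push_cast; module
      · have h3 := t.e_pow_succ_f hv j
        have h4 : (f ^ (j + 1)) v = 0 := by rw [pow_succ', Module.End.mul_apply, hf, map_zero]
        rw [h4, hf, smul_zero, add_zero, map_zero] at h3
        exact h3.symm
    induction j with
    | zero => simpa using hf
    | succ j ihj =>
      have h3 := t.e_pow_succ_f hv j
      rw [hf, hev, map_zero, map_zero, zero_add] at h3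
      rcases smul_eq_zero.1 h3.symm with h4 | h4
      · rcases mul_eq_zero.1 h4 with h5 | h5
        · exact absurd h5 (Nat.cast_add_one_ne_zero j)
        · have : c = j := by exact_mod_cast sub_eq_zero.1 h5
          omega
      · exact ihj (by omega) h4

/-- An infinite ascending string of nonzero weight spaces cannot start at a finite-dimensional
one: the highest weight vectors met along the string would give infinitely many eigenvalues of
`f e` on the bottom space. -/
theorem exists_string_eq_bot (t : NilpSl2 e f h) (W : ℕ → Submodule ℂ V) {c : ℕ}
    (hfin : FiniteDimensional ℂ (W 0)) (he : ∀ j, ∀ v ∈ W j, e v ∈ W (j + 1))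
    (hf : ∀ j, ∀ v ∈ W (j + 1), f v ∈ W j)
    (hh : ∀ j : ℕ, ∀ v ∈ W j, h v = ((c + 2 * j : ℕ) : ℂ) • v) : ∃ j, W j = ⊥ := by
  by_contra! hne
  have hek : ∀ k j v, v ∈ W j → (e ^ k) v ∈ W (j + k) := by
    intro k
    induction k with
    | zero => intro j v hv; simpa using hv
    | succ k ih =>
      intro j v hv
      rw [pow_succ', Module.End.mul_apply]
      exact he _ _ (ih _ _ hv)
  have hfk : ∀ k j v, v ∈ W (j + k) → (f ^ k) v ∈ W j := by
    intro k
    induction k with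
    | zero => intro j v hv; simpa using hv
    | succ k ih =>
      intro j v hv
      rw [pow_succ, Module.End.mul_apply]
      exact ih _ _ (hf _ _ (by simpa [add_assoc] using hv))
  let T : Module.End ℂ (W 0) := (f * e).restrict (p := W 0) (q := W 0)
    (fun v hv => hf 0 _ (he 0 v hv))
  have hT : ∀ J, ∃ m, J ≤ m ∧ T.HasEigenvalue ((m * (c + m + 1) : ℕ) : ℂ) := by
    intro J
    obtain ⟨v, hv, h0⟩ := (Submodule.ne_bot_iff _).1 (hne J)
    obtain ⟨k, h1, h2⟩ := t.exists_primitive h0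
    have hw := hek k J v hv
    set w := (e ^ k) v
    have hh' := hh _ _ hw
    have hw0 : (f ^ (J + k)) w ∈ W 0 := hfk (J + k) 0 w (by simpa using hw)
    refine ⟨J + k, by omega, Module.End.hasEigenvalue_of_hasEigenvector (x := ⟨_, hw0⟩)
      ⟨Module.End.mem_eigenspace_iff.2 (Subtype.ext ?_), ?_⟩⟩
    · change f (e ((f ^ (J + k)) w)) = ((_ : ℕ) : ℂ) • (f ^ (J + k)) w
      rcases hm : J + k with _ | m
      · rw [hm] at *
        simp [h2]
      · rw [t.e_pow_succ_f (hh _ _ hw), h2, map_zero, zero_add, map_smul,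
          ← Module.End.mul_apply f, ← pow_succ', hm]
        congr 1
        push_cast
        ring
    · intro h3
      exact t.pow_f_ne_zero h1 hh' (by omega) (congrArg Subtype.val h3)
  refine Set.infinite_of_not_bddAbove (s := {m : ℕ | T.HasEigenvalue ((m * (c + m + 1) : ℕ) : ℂ)})
    ?_ ?_
  · rintro ⟨M, hM⟩
    obtain ⟨m, h1, h2⟩ := hT (M + 1)
    have := hM h2
    omega
  · refine Set.Finite.of_finite_image (f := fun m : ℕ => ((m * (c + m + 1) : ℕ) : ℂ))
      (T.finite_hasEigenvalue.subset ?_) ?_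
    · rintro _ ⟨m, hm, rfl⟩
      exact hm
    · refine Function.Injective.injOn fun a b hab => ?_
      have hab' : a * (c + a + 1) = b * (c + b + 1) := by exact_mod_cast hab
      nlinarith [lt_trichotomy a b]

end NilpSl2

end Sl2

/-! ### Saturated sets of weights -/

section Saturated

variable {ι M N : Type*} [AddCommGroup M] [Module ℂ M] [AddCommGroup N] [Module ℂ N]
  {P : RootPairing ι ℂ M N}

/-- A set of weights is saturated if it is integral and contains, with every weight `x` and for
every root `α`, the string `x, x - α, …, x - ⟨x, α^∨⟩ α`. -/
def IsSaturated (P : RootPairing ι ℂ M N) (A : Set M) : Prop :=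
  ∀ x ∈ A, ∀ i, ∃ z : ℤ, P.toLinearMap x (P.coroot i) = z ∧
    ∀ j : ℕ, (j : ℤ) ≤ z → x - j • P.root i ∈ A

/-- `x` is dominant integral: its value on the coroot of every positive root is a natural
number. -/
def DominantWt (b : P.Base) (x : M) : Prop :=
  ∀ i, b.IsPos i → ∃ m : ℕ, P.toLinearMap x (P.coroot i) = m

/-- The combination of simple roots with coefficients `k`. -/
def rootSum (b : P.Base) (k : b.support → ℕ) : M := ∑ i, k i • P.root i

theorem rootSum_add (b : P.Base) (k l : b.support → ℕ) :
    rootSum b (k + l) = rootSum b k + rootSum b l := by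
  simp [rootSum, add_smul, Finset.sum_add_distrib]

theorem rootSum_smul (b : P.Base) (j : ℕ) (k : b.support → ℕ) :
    rootSum b (j • k) = j • rootSum b k := by
  simp [rootSum, mul_smul, Finset.smul_sum]

theorem rootSum_single [DecidableEq ι] (b : P.Base) (i : b.support) :
    rootSum b (Pi.single i 1) = P.root i := by
  simp [rootSum, Pi.single_apply, ite_smul]

theorem rootSum_coroot [P.IsCrystallographic] (b : P.Base) (k : b.support → ℕ) (j : b.support) :
    P.toLinearMap (rootSum b k) (P.coroot j) =
      ((∑ i, (k i : ℤ) * b.cartanMatrix i j : ℤ) : ℂ) := by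
  simp only [rootSum, map_sum, LinearMap.coe_sum, Finset.sum_apply, map_nsmul, LinearMap.smul_apply,
    Int.cast_sum, Int.cast_mul]
  refine Finset.sum_congr rfl fun i _ => ?_
  have : ((b.cartanMatrix i j : ℤ) : ℂ) = P.pairing i j := by
    rw [RootPairing.Base.cartanMatrix, RootPairing.Base.cartanMatrixIn_def]
    exact P.algebraMap_pairingIn ℤ i j
  rw [this]
  simp

theorem exists_rootSum_of_isPos (b : P.Base) {i : ι} (hi : b.IsPos i) :
    ∃ k : b.support → ℕ, k ≠ 0 ∧ P.root i = rootSum b k := by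
  obtain ⟨f, hf, h | h⟩ := b.exists_root_eq_sum_nat_or_neg i
  · refine ⟨fun j => f j, ?_, by
      rw [h, rootSum, Finset.sum_coe_sort b.support (fun j => f j • P.root j)]⟩
    intro h0
    apply P.ne_zero i
    rw [h]
    exact Finset.sum_eq_zero fun j hj => by
      have := congrFun h0 ⟨j, hj⟩
      simp only [Pi.zero_apply] at this
      rw [this, zero_smul]
  · exfalso
    have h1 : P.root i = ∑ j ∈ b.support, (fun j => -(f j : ℤ)) j • P.root j := by
      rw [h, ← Finset.sum_neg_distrib]
      exact Finset.sum_congr rfl fun j _ => by simp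
    have h2 := b.height_eq_sum h1
    rw [RootPairing.Base.isPos_iff, h2] at hi
    have : ∑ j ∈ b.support, -(f j : ℤ) ≤ 0 := Finset.sum_nonpos fun j _ => by omega
    omega

variable [Finite ι]

/-- A nonzero combination of simple roots with coefficients `kᵢ ≥ 0` is positive on the coroot of
some `αⱼ` with `kⱼ ≠ 0`, by positive definiteness of the symmetrized Cartan matrix. -/
theorem exists_pos_coroot [P.IsCrystallographic] [P.IsRootSystem] (b : P.Base)
    {k : b.support → ℕ} (hk : k ≠ 0) :
    ∃ j, k j ≠ 0 ∧ 0 < ∑ i, (k i : ℤ) * b.cartanMatrix i j := by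
  classical
  obtain ⟨d, hd, hpos⟩ := b.exists_cartanMatrix_mul_diagaonal_posDef
  have hx : (fun i => (k i : ℤ)) ≠ 0 := by
    contrapose! hk
    funext i
    have := congrFun hk i
    simpa using this
  have h := hpos.dotProduct_mulVec_pos hx
  by_contra! hcon
  refine absurd h (not_lt.2 ?_)
  have : star (fun i => (k i : ℤ)) ⬝ᵥ
      Matrix.mulVec (b.cartanMatrix * Matrix.diagonal d) (fun i => (k i : ℤ)) =
      ∑ j, d j * (k j * ∑ i, (k i : ℤ) * b.cartanMatrix i j) := by
    simp only [dotProduct, Matrix.mulVec, Matrix.mul_diagonal, Finset.mul_sum, star_trivial]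
    rw [Finset.sum_comm]
    refine Finset.sum_congr rfl fun j _ => Finset.sum_congr rfl fun i _ => ?_
    ring
  rw [this]
  refine Finset.sum_nonpos fun j _ => ?_
  by_cases hj : k j = 0
  · simp [hj]
  · exact mul_nonpos_of_nonneg_of_nonpos (hd j).le
      (mul_nonpos_of_nonneg_of_nonpos (by positivity) (hcon j hj))

/-- A saturated set contains every dominant weight below one of its elements. -/
theorem IsSaturated.mem_of_dominant [P.IsCrystallographic] [P.IsRootSystem] {A : Set M}
    (hA : IsSaturated P A) (b : P.Base) {x : M} (hx : DominantWt b x) {k : b.support → ℕ}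
    (hk : x + rootSum b k ∈ A) : x ∈ A := by
  classical
  induction hm : ∑ i, k i generalizing k with
  | zero =>
    have : k = 0 := by
      funext i
      exact Finset.sum_eq_zero_iff.1 hm i (Finset.mem_univ i)
    simpa [this, rootSum] using hk
  | succ m ih =>
    have hk0 : k ≠ 0 := by
      rintro rfl
      simp at hm
    obtain ⟨j, hj, hpos⟩ := exists_pos_coroot b hk0
    have hkj : k = (k - Pi.single j 1) + Pi.single j 1 := by
      funext i
      by_cases h : i = j
      · subst h; simp; omega
      · simp [h]
    obtain ⟨z, hz, hmem⟩ := hA _ hk j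
    obtain ⟨c, hc⟩ := hx j (b.isPos_of_mem_support j.2)
    have hz1 : (1 : ℤ) ≤ z := by
      rw [map_add, LinearMap.add_apply, hc, rootSum_coroot] at hz
      have : (c : ℤ) + ∑ i, (k i : ℤ) * b.cartanMatrix i j = z := by exact_mod_cast hz
      omega
    have h1 := hmem 1 (by exact_mod_cast hz1)
    rw [hkj, rootSum_add, rootSum_single, one_smul, ← add_assoc, add_sub_cancel_right] at h1
    refine ih h1 ?_
    have := congrArg (fun l : b.support → ℕ => ∑ i, l i) hkj
    simp only [Pi.add_apply, Finset.sum_add_distrib, Finset.sum_pi_single', Finset.mem_univ,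
      if_true] at this
    omega

/-- Every element of a saturated set lies below a dominant one, found in its Weyl group orbit; the
orbit is encoded through the permutations of the values on the coroots. -/
theorem IsSaturated.exists_dominant [P.IsRootSystem] {A : Set M} (hA : IsSaturated P A)
    (b : P.Base) {x : M} (hx : x ∈ A) :
    ∃ k : b.support → ℕ, x + rootSum b k ∈ A ∧ DominantWt b (x + rootSum b k) := by
  classical
  let O : Set M := {y | ∃ s : Equiv.Perm ι, ∀ j,
    P.toLinearMap y (P.coroot j) = P.toLinearMap x (P.coroot (s j))}
  have hdet : ∀ y y' : M, (∀ j, P.toLinearMap y (P.coroot j) = P.toLinearMap y' (P.coroot j)) →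
      y = y' := by
    intro y y' h
    have : P.toLinearMap y = P.toLinearMap y' := by
      refine LinearMap.ext_on_range (v := P.coroot) ?_ h
      exact RootPairing.IsRootSystem.span_coroot_eq_top
    exact (LinearMap.IsPerfPair.bijective_left P.toLinearMap).injective this
  have hO : O.Finite := by
    refine Set.Finite.of_finite_image (f := fun y j => P.toLinearMap y (P.coroot j))
      ((Set.finite_range fun s : Equiv.Perm ι => fun j => P.toLinearMap x (P.coroot (s j))).subset
        ?_) ?_
    · rintro _ ⟨y, ⟨s, hs⟩, rfl⟩
      exact ⟨s, funext fun j => (hs j).symm⟩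
    · intro y _ y' _ h
      exact hdet y y' (congrFun h)
  let K : Set (b.support → ℕ) := {k | x + rootSum b k ∈ A ∧ x + rootSum b k ∈ O}
  have hinj : Function.Injective (rootSum b) := by
    intro k l hkl
    have hl : LinearIndependent ℂ fun i : b.support => P.root (i : ι) := b.linearIndepOn_root
    have := Fintype.linearIndependent_iff.1 hl (fun i => (k i : ℂ) - l i) (by
      simp only [sub_smul, Finset.sum_sub_distrib, Nat.cast_smul_eq_nsmul]
      exact sub_eq_zero.2 hkl)
    funext i
    exact_mod_cast sub_eq_zero.1 (this i)
  have hK : K.Finite := by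
    refine Set.Finite.of_finite_image (f := fun k => x + rootSum b k) (hO.subset ?_) ?_
    · rintro _ ⟨k, hk, rfl⟩
      exact hk.2
    · intro k _ l _ h
      exact hinj (add_left_cancel h)
  -- an element of maximal height among those of the orbit which lie above `x`
  obtain ⟨k, hk, hmax⟩ := Set.exists_max_image K (fun k => ∑ i, k i) hK
    ⟨0, by simpa [rootSum] using hx, by simpa [rootSum] using ⟨Equiv.refl _, fun j => rfl⟩⟩
  refine ⟨k, hk.1, fun i hi => ?_⟩
  obtain ⟨z, hz, -⟩ := hA _ hk.1 i
  rcases lt_or_ge z 0 with hneg | hpos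
  · exfalso
    obtain ⟨m, rfl⟩ : ∃ m : ℕ, z = -(m : ℤ) := ⟨z.natAbs, by omega⟩
    obtain ⟨l, hl0, hl⟩ := exists_rootSum_of_isPos b hi
    -- reflecting in a positive root on which the weight is negative moves it up
    have hup : x + rootSum b (k + m • l) = x + rootSum b k + m • P.root i := by
      rw [rootSum_add, rootSum_smul, hl, add_assoc]
    have hmem : k + m • l ∈ K := by
      constructor
      · obtain ⟨z', hz', hmem⟩ := hA _ hk.1 (P.reflectionPerm i i)
        rw [P.coroot_reflectionPerm, P.coreflection_apply_self, map_neg, hz] at hz'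
        have : (m : ℤ) = z' := by
          have : ((m : ℤ) : ℂ) = z' := by rw [← hz']; push_cast; ring
          exact_mod_cast this
        have h1 := hmem m this.le
        rw [P.root_reflectionPerm, P.reflection_apply_self, smul_neg, sub_neg_eq_add] at h1
        rwa [hup]
      · obtain ⟨s, hs⟩ := hk.2
        refine ⟨(P.reflectionPerm i).trans s, fun j => ?_⟩
        have h1 : P.toLinearMap (m • P.root i) (P.coroot j) =
            m * P.toLinearMap (P.root i) (P.coroot j) := by
          rw [map_nsmul, LinearMap.smul_apply, nsmul_eq_mul]
        rw [hup, Equiv.trans_apply, ← hs, P.coroot_reflectionPerm, P.coreflection_apply,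
          map_sub, map_smul, hz, map_add, LinearMap.add_apply, h1]
        have : P.toLinearMap (P.root i) (P.coroot j) = P.root' i (P.coroot j) := rfl
        rw [this]
        push_cast
        simp only [smul_eq_mul]
        ring
    have := hmax _ hmem
    simp only [Pi.add_apply, Pi.smul_apply, smul_eq_mul, Finset.sum_add_distrib,
      ← Finset.mul_sum] at this
    have hlpos : 0 < ∑ i, l i := by
      rw [Nat.pos_iff_ne_zero]
      intro h0
      exact hl0 (funext fun i => Finset.sum_eq_zero_iff.1 h0 i (Finset.mem_univ i))
    have : 0 < m * ∑ i, l i := Nat.mul_pos (by omega) hlpos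
    omega
  · exact ⟨z.toNat, by
      rw [hz]
      exact_mod_cast congrArg (Int.cast (R := ℂ)) (Int.toNat_of_nonneg hpos).symm⟩

/-- A positive root of maximal height is a dominant weight. -/
theorem exists_dominant_root [P.IsCrystallographic] [Nonempty ι] (b : P.Base) :
    ∃ i, b.IsPos i ∧ DominantWt b (P.root i) := by
  have : Nonempty {i // b.IsPos i} := by
    obtain ⟨i, hi⟩ := b.support_nonempty
    exact ⟨⟨i, b.isPos_of_mem_support hi⟩⟩
  obtain ⟨⟨i, hi⟩, hmax⟩ := Finite.exists_max fun i : {i // b.IsPos i} => b.height i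
  refine ⟨i, hi, fun j hj => ?_⟩
  have hp : P.toLinearMap (P.root i) (P.coroot j) = ((P.pairingIn ℤ i j : ℤ) : ℂ) :=
    (P.algebraMap_pairingIn ℤ i j).symm
  rw [hp]
  rcases lt_or_ge (P.pairingIn ℤ i j) 0 with hneg | hpos
  · exfalso
    have hne : P.root i ≠ - P.root j := by
      intro h
      have : P.root i = P.root (P.reflectionPerm j j) := by
        rw [h, P.root_reflectionPerm, P.reflection_apply_self]
      have h2 := P.root.injective this
      have h3 := b.height_reflectionPerm_self j
      rw [RootPairing.Base.isPos_iff] at hi hj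
      change b.height (P.reflectionPerm j j) = _ at h3
      rw [← h2] at h3
      omega
    obtain ⟨l, hl⟩ := P.root_add_root_mem_of_pairingIn_neg hneg hne
    have hh := b.height_add hl
    have hl' : b.IsPos l := hi.add hj hl
    have := hmax ⟨l, hl'⟩
    simp only at this
    rw [RootPairing.Base.isPos_iff] at hj
    omega
  · exact ⟨(P.pairingIn ℤ i j).toNat, by
      exact_mod_cast congrArg (Int.cast (R := ℂ)) (Int.toNat_of_nonneg hpos).symm⟩

/-- By connectedness of the Dynkin diagram, if `x + ∑ kᵢ αᵢ` is dominant and some `kᵢ` is large,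
then every `kᵢ` is large. -/
theorem exists_forall_le_of_dominant [P.IsCrystallographic] [P.IsRootSystem] [P.IsReduced]
    [P.IsIrreducible] (b : P.Base) {x : M} (hx : DominantWt b x) (J : ℕ) :
    ∃ J', ∀ k : b.support → ℕ,
      DominantWt b (x + rootSum b k) → J' ≤ ∑ i, k i → ∀ j, J ≤ k j := by
  classical
  have key : ∀ i j : b.support, ∀ J, ∃ J', ∀ k : b.support → ℕ,
      DominantWt b (x + rootSum b k) → J' ≤ k i → J ≤ k j := by
    intro i j
    refine b.induction_on_cartanMatrix (fun j => ∀ J, ∃ J', ∀ k : b.support → ℕ,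
      DominantWt b (x + rootSum b k) → J' ≤ k i → J ≤ k j) (i := i)
      (fun J => ⟨J, fun k _ h => h⟩) ?_
    intro j l hj hne J
    by_cases hjl : j = l
    · subst hjl; exact hj J
    obtain ⟨c, hc⟩ := hx l (b.isPos_of_mem_support l.2)
    obtain ⟨J', hJ'⟩ := hj (2 * J + c)
    refine ⟨J', fun k hk hki => ?_⟩
    have h1 := hJ' k hk hki
    obtain ⟨m, hm⟩ := hk l (b.isPos_of_mem_support l.2)
    rw [map_add, LinearMap.add_apply, hc, rootSum_coroot] at hm
    have h2 : (c : ℤ) + ∑ i, (k i : ℤ) * b.cartanMatrix i l = m := by exact_mod_cast hm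
    -- off-diagonal Cartan integers are `≤ 0`, and the one at `(j, l)` is `≤ -1`; dominance at `αₗ`
    -- thus reads `0 ≤ c + 2 kₗ - kⱼ`
    have h3 : ∑ i, (k i : ℤ) * b.cartanMatrix i l ≤ (k l : ℤ) * 2 - k j := by
      rw [← Finset.add_sum_erase _ _ (Finset.mem_univ l), b.cartanMatrix_apply_same,
        ← Finset.add_sum_erase _ _ (Finset.mem_erase.2 ⟨hjl, Finset.mem_univ j⟩)]
      have h4 : b.cartanMatrix j l ≤ -1 := by
        have h5 := b.cartanMatrix_le_zero_of_ne j l hjl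
        have h6 : b.cartanMatrix j l ≠ 0 := fun h => hne (b.cartanMatrix_apply_eq_zero_iff_symm.1 h)
        omega
      have h5 : ∑ i ∈ (Finset.univ.erase l).erase j, (k i : ℤ) * b.cartanMatrix i l ≤ 0 := by
        refine Finset.sum_nonpos fun i hi => mul_nonpos_of_nonneg_of_nonpos (by positivity) ?_
        exact b.cartanMatrix_le_zero_of_ne i l (Finset.mem_erase.1 (Finset.mem_erase.1 hi).2).1
      have h6 : (k j : ℤ) * b.cartanMatrix j l ≤ k j * (-1) :=
        mul_le_mul_of_nonneg_left h4 (by positivity)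
      linarith
    omega
  choose F hF using fun i j => key i j J
  refine ⟨∑ i, ((∑ j, F i j) + 1), fun k hk hsum j => ?_⟩
  by_cases hne : Nonempty b.support
  · obtain ⟨i, -, hi⟩ := Finset.exists_le_of_sum_le Finset.univ_nonempty hsum
    refine hF i j k hk (le_trans ?_ hi)
    exact (Finset.single_le_sum (f := fun j => F i j) (fun _ _ => Nat.zero_le _)
      (Finset.mem_univ j)).trans (Nat.le_succ _)
  · exact absurd ⟨j⟩ hne

/-- A saturated set containing arbitrarily high dominant weights above the dominant weight `x`
contains a full ray `x + ℕ α`, where `α` is a dominant root. -/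
theorem IsSaturated.exists_ray [P.IsCrystallographic] [P.IsRootSystem] [P.IsReduced]
    [P.IsIrreducible] [Nonempty ι] {A : Set M} (hA : IsSaturated P A) (b : P.Base) {x : M}
    (hx : DominantWt b x)
    (h : ∀ J : ℕ, ∃ k : b.support → ℕ, J ≤ ∑ i, k i ∧ x + rootSum b k ∈ A ∧
      DominantWt b (x + rootSum b k)) :
    ∃ i, b.IsPos i ∧ ∀ j : ℕ, x + j • P.root i ∈ A := by
  obtain ⟨i, hi, hdom⟩ := exists_dominant_root b
  obtain ⟨l, -, hl⟩ := exists_rootSum_of_isPos b hi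
  refine ⟨i, hi, fun j => ?_⟩
  obtain ⟨J', hJ'⟩ := exists_forall_le_of_dominant b hx (j * ∑ i, l i)
  obtain ⟨k, hk, hkA, hkd⟩ := h J'
  have hle := hJ' k hkd hk
  refine hA.mem_of_dominant b (k := k - j • l) ?_ ?_
  · intro p hp
    obtain ⟨m, hm⟩ := hx p hp
    obtain ⟨m', hm'⟩ := hdom p hp
    exact ⟨m + j * m', by simp [hm, hm']⟩
  · have : k = j • l + (k - j • l) := by
      funext p
      have h1 := hle p
      have h2 : j * l p ≤ j * ∑ i, l i := Nat.mul_le_mul_left _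
        (Finset.single_le_sum (f := fun p => l p) (fun _ _ => Nat.zero_le _) (Finset.mem_univ p))
      simp only [Pi.add_apply, Pi.smul_apply, Pi.sub_apply, smul_eq_mul]
      omega
    rw [hl, ← rootSum_smul, add_assoc, ← rootSum_add, ← this]
    exact hkA

/-- Let `A t` be saturated sets containing no ray `x + ℕ α`. If lowering a weight along a root on
which it is positive leads into one of finitely many of the sets, then the union of the `A t` has a
dominant element to which neither a positive root nor its double can be added. -/
theorem exists_highest [P.IsCrystallographic] [P.IsRootSystem] [P.IsReduced] [P.IsIrreducible]
    [Nonempty ι] (b : P.Base)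
    {T : Type*} (A : T → Set M) (hA : ∀ t, IsSaturated P (A t))
    (hray : ∀ t x i, DominantWt b x → b.IsPos i → ¬ ∀ j : ℕ, x + j • P.root i ∈ A t)
    (F : Set T) (hF : F.Finite)
    (hstep : ∀ t, ∀ x ∈ A t, ∀ i, ∀ m : ℕ, P.toLinearMap x (P.coroot i) = m → 0 < m →
      ∃ t' ∈ F, x - P.root i ∈ A t')
    {t₀ : T} {x₀ : M} (h₀ : x₀ ∈ A t₀) :
    ∃ x t, x ∈ A t ∧ DominantWt b x ∧
      ∀ t' i, b.IsPos i → x + P.root i ∉ A t' ∧ x + 2 • P.root i ∉ A t' := by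
  by_contra! hcon
  -- lowering `x + 2α` gives `x + α`, and lowering `x + α` gives `x` in a set indexed by `F`
  have hup : ∀ x t, x ∈ A t → DominantWt b x →
      (∃ t' ∈ F, x ∈ A t') ∧ ∃ t' k, 1 ≤ ∑ i, k i ∧ x + rootSum b k ∈ A t' ∧
        DominantWt b (x + rootSum b k) := by
    intro x t hxt hx
    obtain ⟨t', i, hi, h⟩ := hcon x t hxt hx
    obtain ⟨m, hm⟩ := hx i hi
    obtain ⟨l, hl0, hl⟩ := exists_rootSum_of_isPos b hi
    have hlpos : 1 ≤ ∑ i, l i := by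
      rw [Nat.one_le_iff_ne_zero]
      intro h0
      exact hl0 (funext fun i => Finset.sum_eq_zero_iff.1 h0 i (Finset.mem_univ i))
    have h2 : P.toLinearMap (P.root i) (P.coroot i) = 2 := P.root_coroot_two i
    obtain ⟨s, hs⟩ : ∃ s, x + P.root i ∈ A s := by
      by_cases h1 : x + P.root i ∈ A t'
      · exact ⟨t', h1⟩
      · obtain ⟨s, -, hs⟩ := hstep t' _ (h h1) i (m + 4)
          (by simp only [map_add, LinearMap.add_apply, map_nsmul, LinearMap.smul_apply, hm, h2]
              push_cast
              simp only [nsmul_eq_mul]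
              norm_num) (by omega)
        refine ⟨s, ?_⟩
        rwa [two_smul, ← add_assoc, add_sub_cancel_right] at hs
    refine ⟨?_, ?_⟩
    · obtain ⟨s', hs', h'⟩ := hstep s _ hs i (m + 2)
        (by simp only [map_add, LinearMap.add_apply, hm, h2]; push_cast; ring) (by omega)
      exact ⟨s', hs', by rwa [add_sub_cancel_right] at h'⟩
    · obtain ⟨k, hk, hkd⟩ := (hA s).exists_dominant b hs
      rw [hl, add_assoc, ← rootSum_add] at hk hkd
      refine ⟨s, l + k, ?_, hk, hkd⟩
      simp only [Pi.add_apply, Finset.sum_add_distrib]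
      omega
  obtain ⟨k₀, hk₀, hd₀⟩ := (hA t₀).exists_dominant b h₀
  set x := x₀ + rootSum b k₀
  have hall : ∀ J : ℕ, ∃ t k, J ≤ ∑ i, k i ∧ x + rootSum b k ∈ A t ∧
      DominantWt b (x + rootSum b k) := by
    intro J
    induction J with
    | zero => exact ⟨t₀, 0, by simp, by simpa [rootSum] using hk₀, by simpa [rootSum] using hd₀⟩
    | succ J ih =>
      obtain ⟨t, k, hJ, hk, hd⟩ := ih
      obtain ⟨-, t', l, hl, hl', hld⟩ := hup _ _ hk hd
      rw [add_assoc, ← rootSum_add] at hl' hld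
      refine ⟨t', k + l, ?_, hl', hld⟩
      simp only [Pi.add_apply, Finset.sum_add_distrib]
      omega
  have hallF : ∀ J : ℕ, ∃ t ∈ F, ∃ k, J ≤ ∑ i, k i ∧ x + rootSum b k ∈ A t ∧
      DominantWt b (x + rootSum b k) := by
    intro J
    obtain ⟨t, k, hJ, hk, hd⟩ := hall J
    obtain ⟨⟨t', ht', h'⟩, -⟩ := hup _ _ hk hd
    exact ⟨t', ht', k, hJ, h', hd⟩
  -- as `F` is finite, a single `A t` contains arbitrarily high ones
  obtain ⟨t, ht⟩ : ∃ t, ∀ J : ℕ, ∃ k, J ≤ ∑ i, k i ∧ x + rootSum b k ∈ A t ∧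
      DominantWt b (x + rootSum b k) := by
    by_contra! hno
    choose G hG using hno
    obtain ⟨M, hM⟩ := (hF.image G).bddAbove
    obtain ⟨t, htF, k, hJ, hk, hd⟩ := hallF M
    exact hG t k ((hM ⟨t, htF, rfl⟩).trans hJ) hk hd
  obtain ⟨i, hi, hr⟩ := (hA t).exists_ray b hd₀ ht
  exact hray t x i hd₀ hi hr

end Saturated

open LieAlgebra LieAlgebra.IsKilling

/-! ### Generalities on Lie modules -/

section Stable

variable {L V : Type*} [LieRing L] [AddCommGroup V] [Module ℂ V]
  [LieRingModule L V]

theorem lie_mem_of_span_left [LieAlgebra ℂ L] [LieModule ℂ L V] {S : Set L} {N N' : Submodule ℂ V}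
    (h : ∀ y ∈ S, ∀ v ∈ N, ⁅y, v⁆ ∈ N') {y : L} (hy : y ∈ Submodule.span ℂ S) {v : V}
    (hv : v ∈ N) : ⁅y, v⁆ ∈ N' := by
  induction hy using Submodule.span_induction with
  | zero => simp
  | add x x' _ _ h h' => rw [add_lie]; exact N'.add_mem h h'
  | smul c x _ h => rw [smul_lie]; exact N'.smul_mem c h
  | mem x hxS => exact h x hxS v hv

theorem eq_top_of_stable [LieModule.IsIrreducible ℂ L V] {N : Submodule ℂ V}
    (h : ∀ y : L, ∀ v ∈ N, ⁅y, v⁆ ∈ N) (h0 : N ≠ ⊥) : N = ⊤ := by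
  let E : LieSubmodule ℂ L V := { N with lie_mem := fun {y v} hv => h y v hv }
  rcases IsSimpleOrder.eq_bot_or_eq_top E with h1 | h1
  · exact absurd (congrArg LieSubmodule.toSubmodule h1) h0
  · exact congrArg LieSubmodule.toSubmodule h1

end Stable

/-- Simultaneous eigenspaces of commuting operators for distinct systems of eigenvalues are
independent. -/
theorem iSupIndep_of_commute {X I V : Type*} [AddCommGroup V] [Module ℂ V]
    (T : X → Module.End ℂ V) (hT : ∀ x y v, T x (T y v) = T y (T x v)) (W : I → Submodule ℂ V)
    (χ : I → X → ℂ) (hχ : Function.Injective χ) (hW : ∀ i, ∀ v ∈ W i, ∀ x, T x v = χ i x • v) :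
    iSupIndep W := by
  have h1 := Module.End.independent_iInf_maxGenEigenspace_of_forall_mapsTo T fun i j φ =>
    Module.End.mapsTo_maxGenEigenspace_of_comm (LinearMap.ext (hT j i)) φ
  refine (h1.comp hχ).mono fun i v hv => ?_
  simp only [Function.comp_apply, Submodule.mem_iInf]
  intro x
  refine (Module.End.mem_maxGenEigenspace _ _ _).2 ⟨1, ?_⟩
  rw [pow_one, LinearMap.sub_apply]
  exact sub_eq_zero.2 (hW i v hv x)

/-! ### Weights of modules over a simple Lie algebra -/

section Weights

variable {L : Type*} [LieRing L] [LieAlgebra ℂ L] [FiniteDimensional ℂ L] [LieAlgebra.IsSimple ℂ L]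
  (H : LieSubalgebra ℂ L) [H.IsCartanSubalgebra]

theorem lie_rootSpace {χ : LieModule.Weight ℂ H L} {x : L} (hx : x ∈ rootSpace H χ) (h : H) :
    ⁅(h : L), x⁆ = χ.toLinear ℂ H L h • x :=
  lie_eq_smul_of_mem_rootSpace hx h

theorem toLinear_eq_zero_or_mem_roots (χ : LieModule.Weight ℂ H L) :
    χ.toLinear ℂ H L = 0 ∨ χ.toLinear ℂ H L ∈ roots H := by
  by_cases hχ : χ.IsZero
  · left
    ext h
    exact congrFun hχ h
  · exact Or.inr ⟨⟨χ, by simpa [LieSubalgebra.root] using hχ⟩, rfl⟩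

/-- The vectors of weight `χ` in an `L`-module. -/
def wtSp (M : Type*) [AddCommGroup M] [Module ℂ M] [LieRingModule L M] [LieModule ℂ L M]
    (χ : Module.Dual ℂ H) : Submodule ℂ M where
  carrier := {v | ∀ h : H, ⁅(h : L), v⁆ = χ h • v}
  add_mem' hx hy h := by rw [lie_add, hx h, hy h, smul_add]
  zero_mem' h := by simp
  smul_mem' c x hx h := by rw [lie_smul, hx h, smul_comm]

/-- A Cartan subalgebra acts diagonalizably on a finite-dimensional irreducible module: the sum of
its weight spaces is a submodule, and it is nonzero by Lie's theorem. -/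
theorem iSup_wtSp_eq_top (M : Type*) [AddCommGroup M] [Module ℂ M] [LieRingModule L M]
    [LieModule ℂ L M] [FiniteDimensional ℂ M] [LieModule.IsIrreducible ℂ L M] :
    ⨆ χ, wtSp H M χ = ⊤ := by
  have : Nontrivial M := LieModule.nontrivial_of_isIrreducible ℂ L M
  let E : LieSubmodule ℂ L M :=
    { (⨆ χ, wtSp H M χ : Submodule ℂ M) with
      lie_mem := by
        intro x m hm
        have hx : x ∈ (⨆ χ : LieModule.Weight ℂ H L,
            (rootSpace H χ).toSubmodule : Submodule ℂ L) := by
          rw [← LieSubmodule.iSup_toSubmodule, LieModule.iSup_genWeightSpace_eq_top' ℂ H L]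
          trivial
        change ⁅x, m⁆ ∈ (⨆ χ, wtSp H M χ : Submodule ℂ M)
        induction hx using Submodule.iSup_induction' with
        | zero => simp
        | add x y _ _ h h' => rw [add_lie]; exact add_mem h h'
        | mem χ x hx =>
          change m ∈ (⨆ χ, wtSp H M χ : Submodule ℂ M) at hm
          induction hm using Submodule.iSup_induction' with
          | zero => simp
          | add x y _ _ h h' => rw [lie_add]; exact add_mem h h'
          | mem ψ v hv =>
            refine Submodule.mem_iSup_of_mem (χ.toLinear ℂ H L + ψ) fun h => ?_
            rw [leibniz_lie, lie_rootSpace H hx, hv h, smul_lie, lie_smul, ← add_smul]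
            rfl }
  have hE : E ≠ ⊥ := by
    obtain ⟨χ, hχ⟩ := LieModule.exists_nontrivial_weightSpace_of_isSolvable ℂ H M
    obtain ⟨⟨v, hv⟩, hv0⟩ := exists_ne (0 : LieModule.weightSpace M χ)
    intro h
    have h1 : v ∈ E := Submodule.mem_iSup_of_mem (p := wtSp H M) χ fun h =>
      (LieModule.mem_weightSpace _ _).1 hv h
    rw [h] at h1
    exact hv0 (Subtype.ext h1)
  have : E = ⊤ := (IsSimpleOrder.eq_bot_or_eq_top E).resolve_left hE
  exact congrArg LieSubmodule.toSubmodule this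

variable {H}

theorem exists_root_of_mem_enlarged {α : Module.Dual ℂ H} (hα : α ∈ enlarged (roots H)) :
    ∃ i, α = (rootSystem H).root i ∨ α = 2 • (rootSystem H).root i := by
  rcases hα with ⟨i, rfl⟩ | ⟨l, ε, ⟨-, hΦ⟩, j, h⟩
  · exact ⟨i, Or.inl rfl⟩
  · have h1 : ε j ∈ roots H := by rw [hΦ]; exact Or.inl ⟨j, Or.inl rfl⟩
    have h2 : - ε j ∈ roots H := by rw [hΦ]; exact Or.inl ⟨j, Or.inr rfl⟩
    rcases h with h | h
    · obtain ⟨i, hi⟩ := h1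
      exact ⟨i, Or.inr (by rw [h, hi]; module)⟩
    · obtain ⟨i, hi⟩ := h2
      exact ⟨i, Or.inr (by rw [h, hi]; module)⟩

variable {B : (rootSystem H).Base}

theorem isPos_root {i : LieSubalgebra.root} (hi : B.IsPos i) : IsPos B ((rootSystem H).root i) := by
  obtain ⟨k, hk, h⟩ := exists_rootSum_of_isPos B hi
  exact ⟨k, hk, h⟩

theorem IsPos.two_smul {α : Module.Dual ℂ H} (h : IsPos B α) : IsPos B (2 • α) := by
  rw [_root_.two_smul]; exact h.add h

theorem IsPos.not_neg {α : Module.Dual ℂ H} (h : IsPos B α) : ¬ IsPos B (-α) := fun h' =>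
  (h.add h').ne_zero (add_neg_cancel α)

theorem isPos_or_neg (i : LieSubalgebra.root) :
    B.IsPos i ∨ IsPos B (-(rootSystem H).root i) := by
  refine (RootPairing.Base.IsPos.or_neg B i).imp_right fun h => ?_
  have := isPos_root h
  change IsPos B ((rootSystem H).root ((rootSystem H).reflectionPerm i i)) at this
  rwa [(rootSystem H).root_reflectionPerm, (rootSystem H).reflection_apply_self] at this

theorem isPos_of_isPos_root {i : LieSubalgebra.root} (h : IsPos B ((rootSystem H).root i)) :
    B.IsPos i :=
  (isPos_or_neg i).resolve_right h.not_neg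

theorem isPos_or_neg_of_mem_enlarged {α : Module.Dual ℂ H} (hα : α ∈ enlarged (roots H)) :
    IsPos B α ∨ IsPos B (-α) := by
  obtain ⟨i, rfl | rfl⟩ := exists_root_of_mem_enlarged hα
  · exact (isPos_or_neg i).imp_left isPos_root
  · refine (isPos_or_neg i).imp (fun h => (isPos_root h).two_smul) fun h => ?_
    rw [← smul_neg]
    exact h.two_smul

theorem exists_pos_root_of_mem_enlarged {α : Module.Dual ℂ H} (hα : α ∈ enlarged (roots H))
    (hpos : IsPos B α) :
    ∃ i, B.IsPos i ∧ (α = (rootSystem H).root i ∨ α = 2 • (rootSystem H).root i) := by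
  obtain ⟨i, hi⟩ := exists_root_of_mem_enlarged hα
  refine ⟨i, (isPos_or_neg i).resolve_right fun h => ?_, hi⟩
  rcases hi with rfl | rfl
  · exact hpos.not_neg h
  · refine hpos.not_neg ?_
    rw [← smul_neg]
    exact h.two_smul

theorem isDominantIntegral_iff {lam : Module.Dual ℂ H} :
    IsDominantIntegral B lam ↔ DominantWt B lam :=
  ⟨fun h i hi => h i (isPos_root hi), fun h i hi => h i (isPos_of_isPos_root hi)⟩

end Weights

namespace MultiloopData

/-! ### The root space decomposition of a Lie torus -/

section Decomposition

variable {n : ℕ} {g : Type*} [LieRing g] [LieAlgebra ℂ g] {D : MultiloopData n g}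
  {H : LieSubalgebra ℂ D.fixed}

theorem mem_fixed_of_mem_gr {k : Lat n} (hk : D.InΓ k) {x : g} (hx : x ∈ D.gr k) : x ∈ D.fixed :=
  fun i => by rw [hx i, ((D.primitive i).zpow_eq_one_iff_dvd _).2 (hk i), one_smul]

theorem coe_mem_gr {k : Lat n} (hk : D.InΓ k) (x : D.fixed) : (x : g) ∈ D.gr k := by
  simpa using gr_add_of_inΓ hk (D.fixed_mem_gr x)

theorem rootSp_mono_gr {k : Lat n} {α : Module.Dual ℂ H} : D.rootSp H k α ≤ D.gr k :=
  fun _ hx => hx.1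

variable [FiniteDimensional ℂ g] [LieAlgebra.IsSimple ℂ D.fixed] [H.IsCartanSubalgebra]

/-- In degrees in `Γ`, the grading space is the simple algebra `g(0̄)`, which decomposes into root
spaces. -/
theorem gr_le_iSup_of_inΓ {k : Lat n} (hk : D.InΓ k) :
    D.gr k ≤ ⨆ χ : LieModule.Weight ℂ H D.fixed, D.rootSp H k (χ.toLinear ℂ H D.fixed) := by
  intro x hx
  have hx' : (⟨x, mem_fixed_of_mem_gr hk hx⟩ : D.fixed) ∈ (⨆ χ : LieModule.Weight ℂ H D.fixed,
      (rootSpace H χ).toSubmodule : Submodule ℂ D.fixed) := by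
    rw [← LieSubmodule.iSup_toSubmodule, LieModule.iSup_genWeightSpace_eq_top' ℂ H D.fixed]
    trivial
  suffices ∀ y ∈ (⨆ χ : LieModule.Weight ℂ H D.fixed,
      (rootSpace H χ).toSubmodule : Submodule ℂ D.fixed),
      (y : g) ∈ ⨆ χ : LieModule.Weight ℂ H D.fixed, D.rootSp H k (χ.toLinear ℂ H D.fixed) from
    this _ hx'
  intro y hy
  induction hy using Submodule.iSup_induction' with
  | zero => exact zero_mem _
  | add x y _ _ h h' => exact add_mem h h'
  | mem χ y hy =>
    exact Submodule.mem_iSup_of_mem χ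
      ⟨coe_mem_gr hk y, fun h => congrArg Subtype.val (lie_rootSpace H hy h)⟩

/-- The `h(0̄)`-weights of `τ` are `0` and elements of the enlarged root system. -/
theorem gr_le_iSup_rootSp (hLT : D.IsLieTorus H) (k : Lat n) :
    D.gr k ≤ ⨆ α : {α : Module.Dual ℂ H // α = 0 ∨ α ∈ enlarged (roots H)}, D.rootSp H k α := by
  by_cases hk : D.InΓ k
  · refine (gr_le_iSup_of_inΓ (H := H) hk).trans (iSup_le fun χ => ?_)
    exact le_iSup (fun α : {α : Module.Dual ℂ H // α = 0 ∨ α ∈ enlarged (roots H)} =>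
      D.rootSp H k α) ⟨χ.toLinear ℂ H D.fixed, (toLinear_eq_zero_or_mem_roots H χ).imp_right Or.inl⟩
  · by_cases hbot : D.gr k = ⊥
    · rw [hbot]; exact bot_le
    obtain ⟨U, W, hUW, -, hU, hW⟩ := hLT.decomp k hk hbot
    rw [← hUW]
    refine sup_le (fun x hx => ?_) ?_
    · refine Submodule.mem_iSup_of_mem ⟨0, Or.inl rfl⟩ ⟨?_, fun h => ?_⟩
      · rw [← hUW]; exact Submodule.mem_sup_left hx
      · simpa using hU (h : D.fixed) x hx
    · rcases hW with rfl | ⟨hfin, hirr, -, hwt⟩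
      · simp
      intro x hx
      have hx' : (⟨x, hx⟩ : W) ∈ ⨆ χ, wtSp H W χ := by rw [iSup_wtSp_eq_top]; trivial
      suffices ∀ y ∈ ⨆ χ, wtSp H W χ, (y : g) ∈
          ⨆ α : {α : Module.Dual ℂ H // α = 0 ∨ α ∈ enlarged (roots H)}, D.rootSp H k α from
        this _ hx'
      intro y hy
      induction hy using Submodule.iSup_induction' with
      | zero => exact zero_mem _
      | add x y _ _ h h' => exact add_mem h h'
      | mem χ y hy =>
        by_cases hy0 : y = 0
        · rw [hy0]; exact zero_mem _
        refine Submodule.mem_iSup_of_mem ⟨χ, hwt χ ⟨y, hy0, hy⟩⟩ ⟨?_, fun h => ?_⟩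
        · rw [← hUW]; exact Submodule.mem_sup_right y.2
        · exact congrArg Subtype.val (hy h)

theorem mem_enlarged_of_mem_rootSp (hLT : D.IsLieTorus H) {k : Lat n} {α : Module.Dual ℂ H}
    (hα : α ≠ 0) {x : g} (hx : x ∈ D.rootSp H k α) (hx0 : x ≠ 0) : α ∈ enlarged (roots H) := by
  by_contra hne
  have hind : iSupIndep fun χ : Module.Dual ℂ H => D.rootSp H k χ := by
    refine iSupIndep_of_commute (fun h : H => LieModule.toEnd ℂ D.fixed g (h : D.fixed)) ?_ _
      (fun χ : Module.Dual ℂ H => (χ : H → ℂ)) DFunLike.coe_injective fun χ y hy h => hy.2 h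
    intro i j x
    have h2 : ⁅(i : D.fixed), (j : D.fixed)⁆ = 0 :=
      congrArg Subtype.val (LieModule.IsTrivial.trivial (L := H) (M := H) i j)
    have h3 := leibniz_lie (i : D.fixed) (j : D.fixed) x
    rw [h2, zero_lie, zero_add] at h3
    exact h3
  have h1 := (hind α)
  refine hx0 ((Submodule.disjoint_def.1 h1) x hx ?_)
  refine (gr_le_iSup_rootSp hLT k).trans (iSup_le ?_) hx.1
  rintro ⟨β, hβ⟩
  have hβα : β ≠ α := by
    rintro rfl
    exact hβ.elim hα hne
  exact le_iSup₂ (f := fun (j : Module.Dual ℂ H) (_ : j ≠ α) => D.rootSp H k j) β hβα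

end Decomposition

end MultiloopData

namespace MultiloopData

/-! ### Weights of the toroidal algebra and its modules -/

section TauWeights

variable {n : ℕ} {g : Type*} [LieRing g] [LieAlgebra ℂ g] {D : MultiloopData n g}
  {H : LieSubalgebra ℂ D.fixed} {κ a b : ℂ}

/-- `y ∈ τ` is a weight vector of weight `ν` for the adjoint action of the Cartan subalgebra. -/
def HasWt (y : D.tau κ a b) (ν : Module.Dual ℂ (Cartan H)) : Prop :=
  ∀ t : Cartan H, ⁅(cartanElt t : D.tau κ a b), y⁆ = ν t • y

theorem delta_apply (β : Fin n → ℂ) (t : Cartan H) : delta H β t = dot t.2.2 β := by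
  simp [delta, dot, dotProduct, mul_comm]

theorem extend_apply (lam : Module.Dual ℂ H) (t : Cartan H) : extend lam t = lam t.1 := rfl

theorem extend_add (x y : Module.Dual ℂ H) : extend (x + y) = extend x + extend y := rfl

theorem extend_zero : extend (0 : Module.Dual ℂ H) = 0 := rfl

theorem delta_add (x y : Fin n → ℂ) : delta H (x + y) = delta H x + delta H y := by
  ext t <;> simp [delta]

theorem delta_zero : delta H (0 : Fin n → ℂ) = 0 := by
  ext t <;> simp [delta]

theorem K_zero (r : Lat n) : (FullToroidal.K r 0 : FullToroidal n g κ a b) = 0 := by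
  ext1 <;> simp [FullToroidal.K]

theorem K_toC_self (r : Lat n) : (FullToroidal.K r (toC r) : FullToroidal n g κ a b) = 0 := by
  ext1 <;> simp [FullToroidal.K]

theorem D_zero (r : Lat n) : (FullToroidal.D 0 r : FullToroidal n g κ a b) = 0 := by
  ext1 <;> simp [FullToroidal.D]

theorem X_smul (k : Lat n) (c : ℂ) (x : g) :
    (FullToroidal.X k (c • x) : FullToroidal n g κ a b) = c • FullToroidal.X k x := by
  ext1 <;> simp [FullToroidal.X]

theorem X_add (k : Lat n) (x y : g) :
    (FullToroidal.X k (x + y) : FullToroidal n g κ a b) =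
      FullToroidal.X k x + FullToroidal.X k y := by
  ext1 <;> simp [FullToroidal.X]

theorem X_zero (k : Lat n) : (FullToroidal.X k 0 : FullToroidal n g κ a b) = 0 := by
  ext1 <;> simp [FullToroidal.X]

theorem D_smul (c : ℂ) (u : Fin n → ℂ) (r : Lat n) :
    (FullToroidal.D (c • u) r : FullToroidal n g κ a b) = c • FullToroidal.D u r := by
  ext1 <;> simp [FullToroidal.D]

theorem coe_cartanElt (t : Cartan H) :
    ((cartanElt t : D.tau κ a b) : FullToroidal n g κ a b) =
      FullToroidal.X 0 ((t.1 : D.fixed) : g) + FullToroidal.K 0 t.2.1 + FullToroidal.D t.2.2 0 :=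
  rfl

theorem coe_smul_tau (c : ℂ) (y : D.tau κ a b) :
    ((c • y : D.tau κ a b) : FullToroidal n g κ a b) = c • (y : FullToroidal n g κ a b) := rfl

theorem hasWt_of_eq_X {y : D.tau κ a b} {k : Lat n} {x : g}
    (hy : (y : FullToroidal n g κ a b) = FullToroidal.X k x) {α : Module.Dual ℂ H}
    (hx : x ∈ D.rootSp H k α) : HasWt y (extend α + delta H (toC k)) := by
  intro t
  apply Subtype.ext
  rw [LieSubalgebra.coe_bracket, coe_cartanElt, hy, add_lie, add_lie, FullToroidal.X_lie_X,
    FullToroidal.K_lie_X, FullToroidal.D_lie_X, hx.2, toC_zero, K_zero, X_smul, zero_add,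
    LinearMap.add_apply, extend_apply, delta_apply, coe_smul_tau, hy]
  module

theorem hasWt_of_eq_K {y : D.tau κ a b} {r : Lat n} {w : Fin n → ℂ}
    (hy : (y : FullToroidal n g κ a b) = FullToroidal.K r w) :
    HasWt (H := H) y (extend 0 + delta H (toC r)) := by
  intro t
  apply Subtype.ext
  rw [LieSubalgebra.coe_bracket, coe_cartanElt, hy, add_lie, add_lie, FullToroidal.K_lie_K,
    FullToroidal.D_lie_K, ← lie_skew, FullToroidal.K_lie_X, toC_zero, K_zero, zero_add,
    LinearMap.add_apply, extend_apply, delta_apply, coe_smul_tau, hy,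
    LinearMap.zero_apply]
  module

theorem hasWt_of_eq_D {y : D.tau κ a b} {r : Lat n} {u : Fin n → ℂ}
    (hy : (y : FullToroidal n g κ a b) = FullToroidal.D u r) :
    HasWt (H := H) y (extend 0 + delta H (toC r)) := by
  intro t
  apply Subtype.ext
  rw [LieSubalgebra.coe_bracket, coe_cartanElt, hy, add_lie, add_lie, FullToroidal.D_lie_D,
    ← lie_skew, FullToroidal.D_lie_X, ← lie_skew (FullToroidal.K _ _), FullToroidal.D_lie_K,
    toC_zero, K_zero, zero_add, add_zero, K_toC_self, dot_zero,
    LinearMap.add_apply, extend_apply, delta_apply, coe_smul_tau, hy,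
    LinearMap.zero_apply, dot_zero]
  simp only [zero_smul, sub_zero, smul_zero, add_zero, neg_zero, zero_add, D_smul]

theorem exists_hasWt_of_mem_partGen {S : Module.Dual ℂ H → Prop} {y : D.tau κ a b}
    (hy : y ∈ D.partGen H κ a b S) :
    ∃ α k, S α ∧ HasWt y (extend α + delta H (toC k)) := by
  obtain ⟨α, k, x, hα, hx, rfl⟩ := hy
  exact ⟨α, k, hα, hasWt_of_eq_X rfl hx⟩

theorem exists_hasWt_of_mem_zeroGen {y : D.tau κ a b} (hy : y ∈ D.zeroGen H κ a b) :
    ∃ k, HasWt (H := H) y (extend 0 + delta H (toC k)) := by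
  rcases hy with (hy | ⟨r, w, -, hy⟩) | ⟨u, r, -, -, hy⟩
  · obtain ⟨α, k, rfl, h⟩ := exists_hasWt_of_mem_partGen hy
    exact ⟨k, h⟩
  · exact ⟨r, hasWt_of_eq_K hy⟩
  · exact ⟨r, hasWt_of_eq_D hy⟩

section Module

variable {V : Type*} [AddCommGroup V] [Module ℂ V] [LieRingModule (D.tau κ a b) V]
  [LieModule ℂ (D.tau κ a b) V]

theorem lie_mem_weightSp {y : D.tau κ a b} {ν μ : Module.Dual ℂ (Cartan H)} (hy : HasWt y ν)
    {v : V} (hv : v ∈ weightSp κ a b V μ) : ⁅y, v⁆ ∈ weightSp κ a b V (μ + ν) := by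
  intro t
  rw [leibniz_lie, hy t, hv t, smul_lie, lie_smul, LinearMap.add_apply]
  module

theorem HasWt.pow_mem_weightSp {y : D.tau κ a b} {ν μ : Module.Dual ℂ (Cartan H)} (hy : HasWt y ν)
    {v : V} (hv : v ∈ weightSp κ a b V μ) (j : ℕ) :
    ((LieModule.toEnd ℂ (D.tau κ a b) V y) ^ j) v ∈ weightSp κ a b V (μ + j • ν) := by
  induction j with
  | zero => simpa using hv
  | succ j ih =>
    rw [pow_succ', Module.End.mul_apply, LieModule.toEnd_apply_apply, succ_nsmul, ← add_assoc]
    exact lie_mem_weightSp hy ih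

variable (κ a b V) in
/-- The eigenspace of `h(0̄)` with eigenvalue `lam` in a `τ`-module. -/
def hWtSp (lam : Module.Dual ℂ H) : Submodule ℂ V where
  carrier := {v | ∀ h : H, ⁅(cartanElt ((h, 0, 0) : Cartan H) : D.tau κ a b), v⁆ = lam h • v}
  add_mem' hx hy h := by rw [lie_add, hx h, hy h, smul_add]
  zero_mem' h := by simp
  smul_mem' c x hx h := by rw [lie_smul, hx h, smul_comm]

theorem weightSp_extend_le (lam : Module.Dual ℂ H) (β : Fin n → ℂ) :
    weightSp κ a b V (extend lam + delta H β) ≤ hWtSp κ a b V lam := by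
  intro v hv h
  rw [hv (h, 0, 0), LinearMap.add_apply, extend_apply, delta_apply]
  simp

theorem lie_mem_hWtSp {y : D.tau κ a b} {α lam : Module.Dual ℂ H} {β : Fin n → ℂ}
    (hy : HasWt y (extend α + delta H β)) {v : V} (hv : v ∈ hWtSp κ a b V lam) :
    ⁅y, v⁆ ∈ hWtSp κ a b V (lam + α) := by
  intro h
  rw [leibniz_lie, hy, hv h, smul_lie, lie_smul, LinearMap.add_apply, LinearMap.add_apply,
    extend_apply, delta_apply]
  simp only [zero_dot]
  module

variable [FiniteDimensional ℂ g] [LieAlgebra.IsSimple ℂ D.fixed] [H.IsCartanSubalgebra]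

variable (κ a b) in
theorem hasWt_cartanElt (s : Cartan H) :
    HasWt (cartanElt s : D.tau κ a b) (0 : Module.Dual ℂ (Cartan H)) := by
  have h0 : extend (0 : Module.Dual ℂ H) + delta H (toC (0 : Lat n)) = 0 := by
    rw [extend_zero, toC_zero, delta_zero, add_zero]
  have hX : HasWt (H := H) (tX 0 ⟨((s.1 : D.fixed) : g), D.fixed_mem_gr _⟩ : D.tau κ a b) 0 := by
    rw [← h0]
    refine hasWt_of_eq_X rfl ⟨D.fixed_mem_gr _, fun h => ?_⟩
    have h2 : ⁅(h : D.fixed), (s.1 : D.fixed)⁆ = 0 :=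
      congrArg Subtype.val (LieModule.IsTrivial.trivial (L := H) (M := H) h s.1)
    rw [LinearMap.zero_apply, zero_smul]
    exact congrArg Subtype.val h2
  have hK : HasWt (H := H) (tK s.2.1 : D.tau κ a b) 0 := by
    rw [← h0]; exact hasWt_of_eq_K rfl
  have hD : HasWt (H := H) (tD s.2.2 : D.tau κ a b) 0 := by
    rw [← h0]; exact hasWt_of_eq_D rfl
  intro t
  have : (cartanElt s : D.tau κ a b) =
    tX 0 ⟨((s.1 : D.fixed) : g), D.fixed_mem_gr _⟩ + tK s.2.1 + tD s.2.2 := rfl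
  rw [this, lie_add, lie_add, hX t, hK t, hD t]
  simp

theorem cartanElt_comm (s t : Cartan H) (v : V) :
    LieModule.toEnd ℂ (D.tau κ a b) V (cartanElt s)
        (LieModule.toEnd ℂ (D.tau κ a b) V (cartanElt t) v) =
      LieModule.toEnd ℂ (D.tau κ a b) V (cartanElt t)
        (LieModule.toEnd ℂ (D.tau κ a b) V (cartanElt s) v) := by
  simp only [LieModule.toEnd_apply_apply]
  rw [leibniz_lie, hasWt_cartanElt κ a b t s]
  simp

variable (H κ a b V) in
theorem iSupIndep_weightSp :
    iSupIndep fun μ : Module.Dual ℂ (Cartan H) => weightSp κ a b V μ :=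
  iSupIndep_of_commute
    (fun t : Cartan H => LieModule.toEnd ℂ (D.tau κ a b) V (cartanElt t : D.tau κ a b))
    (fun s t v => cartanElt_comm s t v) _ (fun μ => (μ : Cartan H → ℂ)) DFunLike.coe_injective
    fun _ _ hv t => hv t

variable (H κ a b V) in
theorem iSupIndep_hWtSp : iSupIndep fun lam : Module.Dual ℂ H => hWtSp κ a b V lam :=
  iSupIndep_of_commute
    (fun h : H => LieModule.toEnd ℂ (D.tau κ a b) V
      (cartanElt ((h, 0, 0) : Cartan H) : D.tau κ a b))
    (fun _ _ v => cartanElt_comm _ _ v) _ (fun μ => (μ : H → ℂ)) DFunLike.coe_injective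
    fun _ _ hv t => hv t

/-! ### The triangular decomposition -/

variable (B : (rootSystem H).Base)

/-- `τ = τ⁻ + τ⁰ + τ⁺`. -/
theorem mem_span_partGen (hLT : D.IsLieTorus H) (z : D.tau κ a b) :
    z ∈ Submodule.span ℂ (D.partGen H κ a b (IsPos B) ∪
      D.partGen H κ a b (fun α => IsPos B (-α)) ∪ D.zeroGen H κ a b) := by
  obtain ⟨z, hz⟩ := z
  change z ∈ Submodule.span ℂ (D.tauGen κ a b) at hz
  induction hz using Submodule.span_induction with
  | zero => exact zero_mem _
  | add x y hx hy h h' => exact add_mem h h'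
  | smul c x hx h => exact Submodule.smul_mem _ c h
  | mem z hz =>
    rcases hz with (⟨k, x, hx, rfl⟩ | ⟨r, w, hr, rfl⟩) | ⟨u, r, hr, hu, rfl⟩
    · have hle : (⨆ α : {α : Module.Dual ℂ H // α = 0 ∨ α ∈ enlarged (roots H)},
          D.rootSp H k α) ≤ D.gr k := iSup_le fun _ => rootSp_mono_gr
      suffices ∀ y, ∀ hy : y ∈ (⨆ α : {α : Module.Dual ℂ H // α = 0 ∨ α ∈ enlarged (roots H)},
          D.rootSp H k α), (tX k ⟨y, hle hy⟩ : D.tau κ a b) ∈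
          Submodule.span ℂ (D.partGen H κ a b (IsPos B) ∪
            D.partGen H κ a b (fun α => IsPos B (-α)) ∪ D.zeroGen H κ a b) from
        this x (gr_le_iSup_rootSp hLT k hx)
      intro y hy
      induction hy using Submodule.iSup_induction' with
      | zero =>
        have h0 : (tX k ⟨0, hle (zero_mem _)⟩ : D.tau κ a b) = 0 := Subtype.ext (X_zero k)
        rw [h0]
        exact zero_mem _
      | add x y hx hy h h' =>
        have h0 : (tX k ⟨x + y, hle (add_mem hx hy)⟩ : D.tau κ a b) =
          tX k ⟨x, hle hx⟩ + tX k ⟨y, hle hy⟩ := Subtype.ext (X_add k x y)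
        rw [h0]
        exact add_mem h h'
      | mem α y hy =>
        apply Submodule.subset_span
        rcases α with ⟨α, rfl | hα⟩
        · exact Or.inr (Or.inl (Or.inl ⟨0, k, _, rfl, hy, rfl⟩))
        · refine Or.inl ((isPos_or_neg_of_mem_enlarged (B := B) hα).imp ?_ ?_)
          · exact fun h => ⟨α, k, _, h, hy, rfl⟩
          · exact fun h => ⟨α, k, _, h, hy, rfl⟩
    · exact Submodule.subset_span (Or.inr (Or.inl (Or.inr ⟨r, w, hr, rfl⟩)))
    · exact Submodule.subset_span (Or.inr (Or.inr ⟨u, r, hr, hu, rfl⟩))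

include B in
/-- In an irreducible module all weights have their `δ`-parts in one coset of `ℤⁿ`. -/
theorem exists_eq_extend_add_delta (hLT : D.IsLieTorus H)
    [LieModule.IsIrreducible ℂ (D.tau κ a b) V] {lam : Module.Dual ℂ H} {β : Fin n → ℂ}
    (h0 : weightSp κ a b V (extend lam + delta H β) ≠ ⊥) {μ : Module.Dual ℂ (Cartan H)}
    (hμ : weightSp κ a b V μ ≠ ⊥) :
    ∃ (q : Module.Dual ℂ H) (r : Lat n), μ = extend q + delta H (toC r + β) := by
  let N : Submodule ℂ V := ⨆ p : Module.Dual ℂ H × Lat n,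
    weightSp κ a b V (extend p.1 + delta H (toC p.2 + β))
  have hN : N = ⊤ := by
    refine eq_top_of_stable (L := D.tau κ a b) (fun y v hv => ?_) ?_
    · refine lie_mem_of_span_left ?_ (mem_span_partGen B hLT y) hv
      intro y hy v hv
      obtain ⟨α, k, hyw⟩ : ∃ α k, HasWt (H := H) y (extend α + delta H (toC k)) := by
        rcases hy with (hy | hy) | hy
        · obtain ⟨α, k, -, h⟩ := exists_hasWt_of_mem_partGen hy
          exact ⟨α, k, h⟩
        · obtain ⟨α, k, -, h⟩ := exists_hasWt_of_mem_partGen hy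
          exact ⟨α, k, h⟩
        · obtain ⟨k, h⟩ := exists_hasWt_of_mem_zeroGen hy
          exact ⟨0, k, h⟩
      induction hv using Submodule.iSup_induction' with
      | zero => simp
      | add x y _ _ h h' => rw [lie_add]; exact add_mem h h'
      | mem p v hv =>
        refine Submodule.mem_iSup_of_mem (p.1 + α, p.2 + k) ?_
        have := lie_mem_weightSp hyw hv
        convert this using 1
        rw [extend_add, toC_add, delta_add, delta_add, delta_add]
        congr 1
        abel
    · refine ne_bot_of_le_ne_bot h0 ?_
      refine le_trans ?_ (le_iSup _ (lam, (0 : Lat n)))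
      simp
  by_contra! hne
  refine hμ (disjoint_self.1 ((iSupIndep_weightSp H κ a b V μ).mono_right ?_))
  refine le_top.trans (hN.symm.le.trans (iSup_le fun p => ?_))
  exact le_iSup₂ (f := fun (ν : Module.Dual ℂ (Cartan H)) (_ : ν ≠ μ) => weightSp κ a b V ν)
    (extend p.1 + delta H (toC p.2 + β)) (hne p.1 p.2).symm

end Module

end TauWeights

end MultiloopData

namespace MultiloopData

/-! ### Existence of highest weight vectors -/

section Reps

variable {n : ℕ} {g : Type*} [LieRing g] [LieAlgebra ℂ g] {D : MultiloopData n g}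

variable (D) in
/-- Representatives of `ℤⁿ / Γ`. -/
def reps : Set (Lat n) := {r | ∀ i, r i ∈ Set.Ico (0 : ℤ) (D.m i)}

theorem finite_reps : D.reps.Finite := by
  have : D.reps = Set.pi Set.univ fun i => Set.Ico (0 : ℤ) (D.m i) := by
    ext r; simp [reps]
  rw [this]
  exact Set.Finite.pi fun i => Set.finite_Ico _ _

theorem exists_sub_mem_reps (t : Lat n) : ∃ l, D.InΓ l ∧ t - l ∈ D.reps := by
  refine ⟨fun i => D.m i * (t i / D.m i), fun i => dvd_mul_right _ _, fun i => ?_⟩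
  have hm : (0 : ℤ) < D.m i := by exact_mod_cast D.m_pos i
  have : (t - fun i => (D.m i : ℤ) * (t i / D.m i)) i = t i % D.m i := by
    rw [Pi.sub_apply, Int.emod_def]
  rw [this]
  exact ⟨Int.emod_nonneg _ hm.ne', Int.emod_lt_of_pos _ hm⟩

end Reps

section Highest

variable {n : ℕ} {g : Type*} [LieRing g] [LieAlgebra ℂ g] [FiniteDimensional ℂ g]
  {D : MultiloopData n g} [LieAlgebra.IsSimple ℂ D.fixed] {H : LieSubalgebra ℂ D.fixed}
  [H.IsCartanSubalgebra] {κ a b : ℂ}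
  {V : Type*} [AddCommGroup V] [Module ℂ V] [LieRingModule (D.tau κ a b) V]
  [LieModule ℂ (D.tau κ a b) V]

theorem neg_mem_roots (i : LieSubalgebra.root) : -(rootSystem H).root i ∈ roots H :=
  ((rootSystem H).neg_mem_range_root_iff).2 ⟨i, rfl⟩

/-- The real root vectors `e ⊗ t^l` and `f ⊗ t^{-l}`, with `l ∈ Γ` and `e`, `f` root vectors of
`g(0̄)`, act as an `sl₂`-triple: the central term of their bracket acts by zero. -/
theorem exists_nilpSl2 (hV : IsIntegrable H κ a b V)
    (hK : ∀ (w : Fin n → ℂ) (v : V), ⁅(tK w : D.tau κ a b), v⁆ = 0) (i : LieSubalgebra.root)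
    {l : Lat n} (hl : D.InΓ l) :
    ∃ E F : D.tau κ a b, NilpSl2 (LieModule.toEnd ℂ (D.tau κ a b) V E)
        (LieModule.toEnd ℂ (D.tau κ a b) V F)
        (LieModule.toEnd ℂ (D.tau κ a b) V
          (cartanElt (((rootSystem H).coroot i, 0, 0) : Cartan H))) ∧
      HasWt E (extend ((rootSystem H).root i) + delta H (toC l)) ∧
      HasWt F (extend (-(rootSystem H).root i) + delta H (toC (-l))) := by
  have hi : (i : LieModule.Weight ℂ H D.fixed).IsNonZero :=
    (Finset.mem_filter.1 i.2).2
  obtain ⟨h, e, f, ht, he, hf⟩ := exists_isSl2Triple_of_weight_isNonZero hi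
  have hh := ht.h_eq_coroot hi he hf
  have hl' : D.InΓ (-l) := fun j => (dvd_neg.2 (hl j) : (D.m j : ℤ) ∣ -(l j))
  have heR : (e : g) ∈ D.rootSp H l ((rootSystem H).root i) :=
    ⟨coe_mem_gr hl e, fun h => congrArg Subtype.val (lie_eq_smul_of_mem_rootSpace he h)⟩
  have hfR : (f : g) ∈ D.rootSp H (-l) (-(rootSystem H).root i) :=
    ⟨coe_mem_gr hl' f, fun h => congrArg Subtype.val (lie_eq_smul_of_mem_rootSpace hf h)⟩
  have hE : HasWt (tX l ⟨e, heR.1⟩ : D.tau κ a b)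
      (extend ((rootSystem H).root i) + delta H (toC l)) := hasWt_of_eq_X rfl heR
  have hF : HasWt (tX (-l) ⟨f, hfR.1⟩ : D.tau κ a b)
      (extend (-(rootSystem H).root i) + delta H (toC (-l))) := hasWt_of_eq_X rfl hfR
  have h2 : (rootSystem H).root i ((rootSystem H).coroot i) = 2 := (rootSystem H).root_coroot_two i
  have hbr : ⁅(tX l ⟨e, heR.1⟩ : D.tau κ a b), (tX (-l) ⟨f, hfR.1⟩ : D.tau κ a b)⁆ =
      cartanElt (((rootSystem H).coroot i, 0, 0) : Cartan H) +
        (κ * killingForm ℂ g (e : g) (f : g)) • tK (toC l) := by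
    apply Subtype.ext
    have h3 : ⁅(e : g), (f : g)⁆ = (((rootSystem H).coroot i : H) : D.fixed) := by
      rw [rootSystem_coroot_apply, ← hh, ← ht.lie_e_f]
      rfl
    change ⁅(FullToroidal.X l (e : g) : FullToroidal n g κ a b), FullToroidal.X (-l) (f : g)⁆ =
      FullToroidal.X 0 ((((rootSystem H).coroot i : H) : D.fixed) : g) + FullToroidal.K 0 0 +
        FullToroidal.D 0 0 + (κ * killingForm ℂ g (e : g) (f : g)) • FullToroidal.K 0 (toC l)
    rw [FullToroidal.X_lie_X, h3, K_zero, D_zero, add_neg_cancel, add_zero, add_zero]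
  refine ⟨_, _, ⟨fun v => ?_, fun v => ?_, fun v => ?_, ?_, ?_⟩, hE, hF⟩
  · simp only [LieModule.toEnd_apply_apply]
    rw [leibniz_lie, hbr, add_lie, smul_lie, hK, smul_zero, add_zero, add_comm]
  · simp only [LieModule.toEnd_apply_apply]
    rw [leibniz_lie, hE, smul_lie, LinearMap.add_apply, extend_apply, delta_apply, h2, zero_dot,
      add_zero, add_comm]
  · simp only [LieModule.toEnd_apply_apply]
    rw [leibniz_lie, hF, smul_lie, LinearMap.add_apply, extend_apply, delta_apply,
      LinearMap.neg_apply, h2, zero_dot, add_zero]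
    module
  · exact hV.nilpotent l _ ((rootSystem H).ne_zero i) (Or.inl ⟨i, rfl⟩) _ heR
  · exact hV.nilpotent (-l) _ (neg_ne_zero.2 ((rootSystem H).ne_zero i))
      (Or.inl (neg_mem_roots i)) _ hfR

variable (H κ a b V) in
/-- The `h(0̄)`-weights of a module in degree `t + β`. -/
def wtSet (β : Fin n → ℂ) (t : Lat n) : Set (Module.Dual ℂ H) :=
  {lam | weightSp κ a b V (extend lam + delta H (toC t + β)) ≠ ⊥}

/-- Weights come in root strings, along which the degree may be shifted by elements of `Γ`. -/
theorem exists_int_of_mem_wtSet (hV : IsIntegrable H κ a b V)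
    (hK : ∀ (w : Fin n → ℂ) (v : V), ⁅(tK w : D.tau κ a b), v⁆ = 0) {β : Fin n → ℂ} {t l : Lat n}
    (hl : D.InΓ l) {lam : Module.Dual ℂ H} (hlam : lam ∈ wtSet H κ a b V β t)
    (i : LieSubalgebra.root) :
    ∃ z : ℤ, lam ((rootSystem H).coroot i) = z ∧
      ∀ j : ℕ, (j : ℤ) ≤ z → lam - j • (rootSystem H).root i ∈ wtSet H κ a b V β (t - j • l) := by
  obtain ⟨E, F, hs, hE, hF⟩ := exists_nilpSl2 hV hK i hl
  obtain ⟨v, hv, hv0⟩ := (Submodule.ne_bot_iff _).1 hlam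
  have hhv : LieModule.toEnd ℂ (D.tau κ a b) V
      (cartanElt (((rootSystem H).coroot i, 0, 0) : Cartan H)) v =
      lam ((rootSystem H).coroot i) • v := weightSp_extend_le _ _ hv _
  obtain ⟨z, hz⟩ := hs.weight_int hv0 hhv
  refine ⟨z, hz, fun j hj => ?_⟩
  obtain ⟨c, rfl⟩ : ∃ c : ℕ, z = c := ⟨z.toNat, by omega⟩
  rw [hz] at hhv
  have hne := hs.pow_f_ne_zero (c := c) hv0 (by exact_mod_cast hhv) (j := j) (by exact_mod_cast hj)
  refine (Submodule.ne_bot_iff _).2 ⟨_, ?_, hne⟩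
  have hμ : extend (lam - j • (rootSystem H).root i) + delta H (toC (t - j • l) + β) =
      extend lam + delta H (toC t + β) +
        j • (extend (-(rootSystem H).root i) + delta H (toC (-l))) := by
    refine LinearMap.ext fun x => ?_
    have hC : toC (t - j • l) = toC t - (j : ℂ) • toC l := by
      ext; simp [toC]
    have hC' : toC (-l) = (-1 : ℂ) • toC l := by
      ext; simp [toC]
    rw [hC, hC']
    simp only [LinearMap.add_apply, LinearMap.smul_apply, extend_apply, delta_apply,
      LinearMap.sub_apply, LinearMap.neg_apply, dot_add, dot_sub, dot_smul, nsmul_eq_mul]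
    ring
  rw [hμ]
  exact hF.pow_mem_weightSp hv j

theorem isSaturated_wtSet (hV : IsIntegrable H κ a b V)
    (hK : ∀ (w : Fin n → ℂ) (v : V), ⁅(tK w : D.tau κ a b), v⁆ = 0) (β : Fin n → ℂ) (t : Lat n) :
    IsSaturated (rootSystem H) (wtSet H κ a b V β t) := by
  intro lam hlam i
  obtain ⟨z, hz, h⟩ := exists_int_of_mem_wtSet hV hK D.inΓ_zero hlam i
  exact ⟨z, hz, fun j hj => by simpa using h j hj⟩

/-- Weight spaces being finite-dimensional, no degree contains a full ray of weights. -/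
theorem not_ray_wtSet (hV : IsIntegrable H κ a b V)
    (hK : ∀ (w : Fin n → ℂ) (v : V), ⁅(tK w : D.tau κ a b), v⁆ = 0) (β : Fin n → ℂ) (t : Lat n)
    {lam : Module.Dual ℂ H} {i : LieSubalgebra.root} {c : ℕ}
    (hc : lam ((rootSystem H).coroot i) = c) :
    ¬ ∀ j : ℕ, lam + j • (rootSystem H).root i ∈ wtSet H κ a b V β t := by
  intro hray
  obtain ⟨E, F, hs, hE, hF⟩ := exists_nilpSl2 hV hK i D.inΓ_zero
  have h2 : (rootSystem H).root i ((rootSystem H).coroot i) = 2 := (rootSystem H).root_coroot_two i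
  obtain ⟨j, hj⟩ := hs.exists_string_eq_bot (c := c)
    (fun j => weightSp κ a b V
      (extend (lam + j • (rootSystem H).root i) + delta H (toC t + β))) (hV.finite _)
    (fun j v hv => by
      convert lie_mem_weightSp hE hv using 1
      rw [toC_zero, delta_zero, add_zero, add_right_comm, ← extend_add, succ_nsmul, add_assoc]
      rfl)
    (fun j v hv => by
      convert lie_mem_weightSp hF hv using 1
      rw [neg_zero, toC_zero, delta_zero, add_zero, add_right_comm, ← extend_add, succ_nsmul,
        add_assoc, add_assoc, add_neg_cancel, add_zero]
      rfl)
    (fun j v hv => by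
      have := weightSp_extend_le _ _ hv ((rootSystem H).coroot i)
      rw [LieModule.toEnd_apply_apply, this, LinearMap.add_apply, hc, LinearMap.smul_apply, h2]
      push_cast
      rw [nsmul_eq_mul, mul_comm])
  exact hray j hj

theorem nonempty_root : Nonempty (LieSubalgebra.root (H := H)) := by
  by_contra hne
  rw [not_nonempty_iff] at hne
  have h1 := RootPairing.IsRootSystem.span_root_eq_top (P := rootSystem H)
  rw [Set.range_eq_empty, Submodule.span_empty] at h1
  have : Nontrivial (Module.Dual ℂ H) := RootPairing.IsIrreducible.nontrivial (P := rootSystem H)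
  exact bot_ne_top h1

/-- A nonzero weight vector killed by `τ⁺`, of dominant integral weight. -/
theorem exists_highest_weight [Nontrivial V] (hLT : D.IsLieTorus H)
    (B : (rootSystem H).Base) (hV : IsIntegrable H κ a b V)
    (hK : ∀ (w : Fin n → ℂ) (v : V), ⁅(tK w : D.tau κ a b), v⁆ = 0) :
    ∃ (lam : Module.Dual ℂ H) (β : Fin n → ℂ), IsDominantIntegral B lam ∧
      weightSp κ a b V (extend lam + delta H β) ≠ ⊥ ∧
      weightSp κ a b V (extend lam + delta H β) ≤ (Vplus κ a b V B : Submodule ℂ V) := by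
  obtain ⟨μ, hμ⟩ : ∃ μ : Module.Dual ℂ (Cartan H), weightSp κ a b V μ ≠ ⊥ := by
    by_contra! h
    have := hV.iSup_weightSp
    simp only [h, iSup_bot] at this
    exact bot_ne_top this
  obtain ⟨lam₀, β, rfl⟩ : ∃ lam β, μ = extend lam + delta H β := by
    refine ⟨μ ∘ₗ LinearMap.inl ℂ _ _, fun i => μ (0, 0, Pi.single i 1), ?_⟩
    obtain ⟨v, hv, hv0⟩ := (Submodule.ne_bot_iff _).1 hμ
    have hμK : ∀ w : Fin n → ℂ, μ (0, w, 0) = 0 := by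
      intro w
      have h1 := hv (0, w, 0)
      have h2 : (cartanElt ((0, w, 0) : Cartan H) : D.tau κ a b) = tK w := by
        apply Subtype.ext
        rw [coe_cartanElt]
        change FullToroidal.X 0 0 + FullToroidal.K 0 w + FullToroidal.D 0 0 = FullToroidal.K 0 w
        rw [X_zero, D_zero, zero_add, add_zero]
      rw [h2, hK] at h1
      exact (smul_eq_zero.1 h1.symm).resolve_right hv0
    have h00 : μ (0, 0) = 0 := map_zero μ
    ext x
    · simp [extend, delta]
    · simpa [extend, delta, h00] using hμK _
    · simp [extend, delta, h00]
  have := nonempty_root (H := H)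
  obtain ⟨lam, t, hmem, hdom, htop⟩ := exists_highest B (wtSet H κ a b V β)
    (isSaturated_wtSet hV hK β)
    (fun t x i hx hi => by
      obtain ⟨c, hc⟩ := hx i hi
      exact not_ray_wtSet hV hK β t hc)
    D.reps finite_reps
    (fun t x hx i m hm hpos => by
      obtain ⟨l, hl, hrep⟩ := exists_sub_mem_reps (D := D) t
      obtain ⟨z, hz, h⟩ := exists_int_of_mem_wtSet hV hK hl hx i
      refine ⟨t - l, hrep, ?_⟩
      have hzm : z = m := by
        have : (z : ℂ) = m := hz.symm.trans hm
        exact_mod_cast this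
      simpa using h 1 (by omega))
    (t₀ := 0) (x₀ := lam₀) (by simpa [wtSet] using hμ)
  refine ⟨lam, toC t + β, isDominantIntegral_iff.2 hdom, hmem, fun v hv x hx => ?_⟩
  have hbot : ⁅x, v⁆ ∈ (⊥ : Submodule ℂ V) := by
    refine lie_mem_of_span_left ?_ (show x ∈ Submodule.span ℂ (D.partGen H κ a b (IsPos B)) from hx)
      hv
    rintro _ ⟨α, k, x, hα, hx, rfl⟩ v hv
    have hwt : HasWt (tX k x : D.tau κ a b) (extend α + delta H (toC k)) := hasWt_of_eq_X rfl hx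
    have h1 := lie_mem_weightSp hwt hv
    by_cases hx0 : (x : g) = 0
    · have : (tX k x : D.tau κ a b) = 0 := by
        apply Subtype.ext
        change FullToroidal.X k (x : g) = 0
        rw [hx0, X_zero]
      rw [this, zero_lie]
      exact zero_mem _
    · obtain ⟨i, hi, hαi⟩ := exists_pos_root_of_mem_enlarged
        (mem_enlarged_of_mem_rootSp hLT hα.ne_zero hx hx0) hα
      have h2 : extend lam + delta H (toC t + β) + (extend α + delta H (toC k)) =
          extend (lam + α) + delta H (toC (t + k) + β) := by
        rw [extend_add, toC_add, delta_add, delta_add, delta_add]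
        abel
      rw [h2] at h1
      have h3 : lam + α ∉ wtSet H κ a b V β (t + k) := by
        rcases hαi with rfl | rfl
        · exact (htop (t + k) i hi).1
        · exact (htop (t + k) i hi).2
      rw [wtSet, Set.mem_ofPred_eq, not_not] at h3
      rwa [h3] at h1
  simpa using hbot

end Highest

end MultiloopData

/-! ### Submodules generated over the enveloping algebra -/

/-- A subspace stable under a Lie algebra is stable under its universal enveloping algebra. -/
theorem lift_apply_mem {L V : Type*} [LieRing L] [LieAlgebra ℂ L] [AddCommGroup V] [Module ℂ V]
    [LieRingModule L V] [LieModule ℂ L V] {N : Submodule ℂ V}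
    (h : ∀ x : L, ∀ v ∈ N, ⁅x, v⁆ ∈ N) (u : UniversalEnvelopingAlgebra ℂ L) {v : V} (hv : v ∈ N) :
    UniversalEnvelopingAlgebra.lift ℂ (LieModule.toEnd ℂ L V) u v ∈ N := by
  obtain ⟨w, rfl⟩ : ∃ w, UniversalEnvelopingAlgebra.mkAlgHom ℂ L w = u :=
    RingCon.mk'_surjective _ u
  induction w using TensorAlgebra.induction generalizing v with
  | algebraMap c =>
    rw [AlgHom.commutes, AlgHom.commutes]
    exact N.smul_mem c hv
  | ι x =>
    rw [UniversalEnvelopingAlgebra.lift_ι_apply']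
    exact h x v hv
  | mul x y hx hy =>
    rw [map_mul, map_mul, Module.End.mul_apply]
    exact hx (hy hv)
  | add x y hx hy =>
    rw [map_add, map_add, LinearMap.add_apply]
    exact add_mem (hx hv) (hy hv)

namespace MultiloopData

section Generation

variable {n : ℕ} {g : Type*} [LieRing g] [LieAlgebra ℂ g]
  {D : MultiloopData n g} {κ a b : ℂ}
  {V : Type*} [AddCommGroup V] [Module ℂ V] [LieRingModule (D.tau κ a b) V]
  [LieModule ℂ (D.tau κ a b) V]

theorem le_envSpan (S : LieSubalgebra ℂ (D.tau κ a b)) (N : Submodule ℂ V) :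
    N ≤ envSpan V S N := fun v hv =>
  Submodule.subset_span ⟨1, v, hv, by simp⟩

theorem lie_mem_envSpan {S : LieSubalgebra ℂ (D.tau κ a b)} {N : Submodule ℂ V}
    {x : D.tau κ a b} (hx : x ∈ S) {v : V} (hv : v ∈ envSpan V S N) : ⁅x, v⁆ ∈ envSpan V S N := by
  induction hv using Submodule.span_induction with
  | zero => simp
  | add v w _ _ h h' => rw [lie_add]; exact add_mem h h'
  | smul c v _ h => rw [lie_smul]; exact Submodule.smul_mem _ c h
  | mem v hv =>
    obtain ⟨u, w, hw, rfl⟩ := hv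
    refine Submodule.subset_span ⟨UniversalEnvelopingAlgebra.ι ℂ (⟨x, hx⟩ : S) * u, w, hw, ?_⟩
    rw [map_mul, UniversalEnvelopingAlgebra.lift_ι_apply, Module.End.mul_apply]
    rfl

theorem envSpan_le {S : LieSubalgebra ℂ (D.tau κ a b)} {N C : Submodule ℂ V} (hN : N ≤ C)
    (hC : ∀ x ∈ S, ∀ v ∈ C, ⁅x, v⁆ ∈ C) : envSpan V S N ≤ C := by
  refine Submodule.span_le.2 ?_
  rintro _ ⟨u, v, hv, rfl⟩
  exact lift_apply_mem (L := S) (fun x v hv => hC x x.2 v hv) u (hN hv)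

variable {H : LieSubalgebra ℂ D.fixed}

theorem lie_zeroGen_mem_hWtSp {y : D.tau κ a b} (hy : y ∈ D.zeroGen H κ a b)
    {lam : Module.Dual ℂ H} {v : V} (hv : v ∈ hWtSp κ a b V lam) :
    ⁅y, v⁆ ∈ hWtSp κ a b V lam := by
  obtain ⟨k, hk⟩ := exists_hasWt_of_mem_zeroGen (H := H) hy
  simpa using lie_mem_hWtSp hk hv

variable [FiniteDimensional ℂ g] [LieAlgebra.IsSimple ℂ D.fixed]
  [H.IsCartanSubalgebra] {B : (rootSystem H).Base}

/-- The `τ⁻`-module generated by a nonzero `τ⁰`-stable space `N` of vectors killed by `τ⁺` is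
`τ`-stable: if `x ∈ τ⁻` and `τ w ⊆ U(τ⁻) N`, then `z x w = x z w + [z, x] w` shows that
`τ x w ⊆ U(τ⁻) N`. -/
theorem envSpan_eq_top (hLT : D.IsLieTorus H) [LieModule.IsIrreducible ℂ (D.tau κ a b) V]
    {N : Submodule ℂ V} (hN : N ≤ (Vplus κ a b V B : Submodule ℂ V))
    (hN0 : ∀ y ∈ D.zeroGen H κ a b, ∀ v ∈ N, ⁅y, v⁆ ∈ N) (h0 : N ≠ ⊥) :
    envSpan V (tauNeg κ a b B) N = ⊤ := by
  set W := envSpan V (tauNeg κ a b B) N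
  let C : Submodule ℂ V :=
    { carrier := {v | v ∈ W ∧ ∀ z : D.tau κ a b, ⁅z, v⁆ ∈ W}
      add_mem' := fun hx hy => ⟨add_mem hx.1 hy.1, fun z => by
        rw [lie_add]; exact add_mem (hx.2 z) (hy.2 z)⟩
      zero_mem' := ⟨zero_mem _, fun z => by simp⟩
      smul_mem' := fun c x hx => ⟨Submodule.smul_mem _ c hx.1, fun z => by
        rw [lie_smul]; exact Submodule.smul_mem _ c (hx.2 z)⟩ }
  have hWC : W ≤ C := by
    refine envSpan_le (fun v hv => ⟨le_envSpan _ _ hv, fun z => ?_⟩) ?_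
    · refine lie_mem_of_span_left (N := N) ?_ (mem_span_partGen B hLT z) hv
      rintro y ((hy | hy) | hy) v hv
      · have h1 : ⁅y, v⁆ = 0 := hN hv y (Submodule.subset_span hy)
        rw [h1]
        exact zero_mem _
      · exact lie_mem_envSpan (Submodule.subset_span hy) (le_envSpan _ _ hv)
      · exact le_envSpan _ _ (hN0 y hy v hv)
    · intro x hx v hv
      refine ⟨lie_mem_envSpan hx hv.1, fun z => ?_⟩
      rw [leibniz_lie]
      exact add_mem (hv.2 _) (lie_mem_envSpan hx (hv.2 z))
  refine eq_top_of_stable (L := D.tau κ a b) (fun z v hv => (hWC hv).2 z) ?_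
  exact ne_bot_of_le_ne_bot h0 (le_envSpan _ _)

/-! ### The highest weight space -/

theorem lie_mem_Vplus {y : D.tau κ a b} (hy : y ∈ D.zeroGen H κ a b) {v : V}
    (hv : v ∈ Vplus κ a b V B) : ⁅y, v⁆ ∈ Vplus κ a b V B :=
  (Vplus κ a b V B).lie_mem (x := (⟨y, Submodule.subset_span hy⟩ : D.tauZero H κ a b)) hv

variable (κ a b V B) in
/-- The sum of the eigenspaces of `h(0̄)` for the eigenvalues strictly below `lam`. -/
def lowerSp (lam : Module.Dual ℂ H) : Submodule ℂ V :=
  ⨆ ξ : {ξ : Module.Dual ℂ H // IsPos B ξ}, hWtSp κ a b V (lam - (ξ : Module.Dual ℂ H))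

theorem lie_zeroGen_mem_lowerSp {y : D.tau κ a b} (hy : y ∈ D.zeroGen H κ a b)
    {lam : Module.Dual ℂ H} {v : V} (hv : v ∈ lowerSp κ a b V B lam) :
    ⁅y, v⁆ ∈ lowerSp κ a b V B lam := by
  induction hv using Submodule.iSup_induction' with
  | zero => simp
  | add v w _ _ h h' => rw [lie_add]; exact add_mem h h'
  | mem ξ v hv => exact Submodule.mem_iSup_of_mem ξ (lie_zeroGen_mem_hWtSp hy hv)

theorem lie_tauNeg_mem_lowerSp {x : D.tau κ a b} (hx : x ∈ tauNeg κ a b B)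
    {lam : Module.Dual ℂ H} {v : V} (hv : v ∈ hWtSp κ a b V lam ⊔ lowerSp κ a b V B lam) :
    ⁅x, v⁆ ∈ lowerSp κ a b V B lam := by
  refine lie_mem_of_span_left ?_
    (show x ∈ Submodule.span ℂ (D.partGen H κ a b fun α => IsPos B (-α)) from hx) hv
  intro y hy v hv
  obtain ⟨α, k, hα, hy⟩ := exists_hasWt_of_mem_partGen hy
  obtain ⟨p, hp, w, hw, hpw⟩ := Submodule.mem_sup.1 hv
  rw [← hpw, lie_add]
  clear hpw hv
  refine add_mem ?_ ?_
  · refine Submodule.mem_iSup_of_mem ⟨-α, hα⟩ ?_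
    simpa using lie_mem_hWtSp hy hp
  · induction hw using Submodule.iSup_induction' with
    | zero => simp
    | add v w _ _ h h' => rw [lie_add]; exact add_mem h h'
    | mem ξ v hv =>
      refine Submodule.mem_iSup_of_mem ⟨ξ + -α, ξ.2.add hα⟩ ?_
      convert lie_mem_hWtSp hy hv using 2
      rw [sub_add_eq_sub_sub, sub_neg_eq_add]

theorem disjoint_hWtSp_lowerSp (lam : Module.Dual ℂ H) :
    Disjoint (hWtSp κ a b V lam) (lowerSp κ a b V B lam) := by
  refine (iSupIndep_hWtSp H κ a b V lam).mono_right (iSup_le fun ξ => ?_)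
  refine le_iSup₂ (f := fun (ν : Module.Dual ℂ H) (_ : ν ≠ lam) => hWtSp κ a b V ν)
    (lam - ξ) ?_
  rw [Ne, sub_eq_self]
  exact ξ.2.ne_zero

/-- A nonzero `τ⁰`-stable space of vectors of `h(0̄)`-weight `lam` killed by `τ⁺` generates the
module over `τ⁻`, so it is the full eigenspace, and all other eigenvalues are lower. -/
theorem eq_hWtSp_of_stable (hLT : D.IsLieTorus H) [LieModule.IsIrreducible ℂ (D.tau κ a b) V]
    {lam : Module.Dual ℂ H} {N : Submodule ℂ V} (hN : N ≤ (Vplus κ a b V B : Submodule ℂ V))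
    (hlam : N ≤ hWtSp κ a b V lam) (hN0 : ∀ y ∈ D.zeroGen H κ a b, ∀ v ∈ N, ⁅y, v⁆ ∈ N)
    (h0 : N ≠ ⊥) : N = hWtSp κ a b V lam ∧ N ⊔ lowerSp κ a b V B lam = ⊤ := by
  have htop : N ⊔ lowerSp κ a b V B lam = ⊤ := by
    rw [eq_top_iff, ← envSpan_eq_top hLT hN hN0 h0]
    refine envSpan_le le_sup_left fun x hx v hv => Submodule.mem_sup_right ?_
    exact lie_tauNeg_mem_lowerSp hx (sup_le_sup_right hlam _ hv)
  refine ⟨le_antisymm hlam fun v hv => ?_, htop⟩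
  have hv' : v ∈ N ⊔ lowerSp κ a b V B lam := by rw [htop]; trivial
  obtain ⟨x, hx, w, hw, rfl⟩ := Submodule.mem_sup.1 hv'
  have hwl : w ∈ hWtSp κ a b V lam := by
    simpa using sub_mem hv (hlam hx)
  rw [Submodule.disjoint_def.1 (disjoint_hWtSp_lowerSp lam) w hwl hw, add_zero]
  exact hx

/-- If a vector of `h(0̄)`-weight `lam` is killed by `τ⁺`, then `V₊` is the eigenspace of
`h(0̄)` for `lam`. -/
theorem Vplus_eq_hWtSp (hLT : D.IsLieTorus H) [LieModule.IsIrreducible ℂ (D.tau κ a b) V]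
    {lam : Module.Dual ℂ H}
    (h : (Vplus κ a b V B : Submodule ℂ V) ⊓ hWtSp κ a b V lam ≠ ⊥) :
    (Vplus κ a b V B : Submodule ℂ V) = hWtSp κ a b V lam := by
  obtain ⟨h1, h2⟩ := eq_hWtSp_of_stable hLT inf_le_left inf_le_right
    (fun y hy v hv => ⟨lie_mem_Vplus hy hv.1, lie_zeroGen_mem_hWtSp hy hv.2⟩) h
  have hle : hWtSp κ a b V lam ≤ (Vplus κ a b V B : Submodule ℂ V) := by
    rw [← h1]; exact inf_le_left
  refine le_antisymm ?_ hle
  -- otherwise the part of `V₊` of lower weights would generate the module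
  by_cases hL : (Vplus κ a b V B : Submodule ℂ V) ⊓ lowerSp κ a b V B lam = ⊥
  · intro v hv
    have hv' : v ∈ (Vplus κ a b V B : Submodule ℂ V) ⊓ hWtSp κ a b V lam ⊔
        lowerSp κ a b V B lam := by rw [h2]; trivial
    obtain ⟨x, hx, w, hw, rfl⟩ := Submodule.mem_sup.1 hv'
    have hw0 : w ∈ (Vplus κ a b V B : Submodule ℂ V) ⊓ lowerSp κ a b V B lam :=
      ⟨by simpa using sub_mem hv hx.1, hw⟩
    rw [hL, Submodule.mem_bot] at hw0
    rw [hw0, add_zero]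
    exact hx.2
  · exfalso
    have h3 := envSpan_eq_top hLT (B := B)
      (N := (Vplus κ a b V B : Submodule ℂ V) ⊓ lowerSp κ a b V B lam) inf_le_left
      (fun y hy v hv => ⟨lie_mem_Vplus hy hv.1, lie_zeroGen_mem_lowerSp hy hv.2⟩) hL
    have h4 : lowerSp κ a b V B lam = ⊤ := by
      rw [eq_top_iff, ← h3]
      exact envSpan_le inf_le_right fun x hx v hv =>
        lie_tauNeg_mem_lowerSp hx (Submodule.mem_sup_right hv)
    have h5 := disjoint_hWtSp_lowerSp (κ := κ) (a := a) (b := b) (V := V) (B := B) lam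
    rw [h4, disjoint_top] at h5
    rw [h5, inf_bot_eq] at h
    exact h rfl

end Generation

end MultiloopData

end ToroidalEALA

end

theorem mainTheorem5 {n : ℕ} {g : Type*} [LieRing g] [LieAlgebra ℂ g] [FiniteDimensional ℂ g]
    [LieAlgebra.IsSimple ℂ g] (D : ToroidalEALA.MultiloopData n g)
    [LieAlgebra.IsSimple ℂ D.fixed] (H : LieSubalgebra ℂ D.fixed) [H.IsCartanSubalgebra]
    (hLT : D.IsLieTorus H) (B : (LieAlgebra.IsKilling.rootSystem H).Base)
    (κ a b : ℂ) (hκ : κ ≠ 0)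
    {V : Type*} [AddCommGroup V] [Module ℂ V] [LieRingModule (D.tau κ a b) V]
    [LieModule ℂ (D.tau κ a b) V] [LieModule.IsIrreducible ℂ (D.tau κ a b) V]
    (hV : ToroidalEALA.MultiloopData.IsIntegrable H κ a b V)
    (hK : ∀ (w : Fin n → ℂ) (v : V),
      ⁅(ToroidalEALA.MultiloopData.tK w : D.tau κ a b), v⁆ = 0) :
    ToroidalEALA.MultiloopData.Vplus κ a b V B ≠ ⊥ ∧
    LieModule.IsIrreducible ℂ (D.tauZero H κ a b) (ToroidalEALA.MultiloopData.Vplus κ a b V B) ∧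
    ToroidalEALA.MultiloopData.envSpan V (ToroidalEALA.MultiloopData.tauNeg κ a b B)
      (ToroidalEALA.MultiloopData.Vplus κ a b V B : Submodule ℂ V) = ⊤ ∧
    ∃ lam : Module.Dual ℂ H,
      ToroidalEALA.IsDominantIntegral B lam ∧
      ToroidalEALA.MultiloopData.WeightsOfForm κ a b V B lam ∧
      ∀ lam' : Module.Dual ℂ H,
        ToroidalEALA.MultiloopData.WeightsOfForm κ a b V B lam' → lam' = lam := by
  open ToroidalEALA ToroidalEALA.MultiloopData in
  have : Nontrivial V := LieModule.nontrivial_of_isIrreducible ℂ (D.tau κ a b) V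
  obtain ⟨lam, β, hdom, hne, hle⟩ := exists_highest_weight hLT B hV hK
  have hVp : (Vplus κ a b V B : Submodule ℂ V) = hWtSp κ a b V lam :=
    Vplus_eq_hWtSp hLT (ne_bot_of_le_ne_bot hne (le_inf hle (weightSp_extend_le lam β)))
  have hbot : (Vplus κ a b V B : Submodule ℂ V) ≠ ⊥ := ne_bot_of_le_ne_bot hne hle
  have hbot' : Vplus κ a b V B ≠ ⊥ := fun h => hbot (congrArg LieSubmodule.toSubmodule h)
  have : Nontrivial (Vplus κ a b V B) := (LieSubmodule.nontrivial_iff_ne_bot _ _ _).2 hbot'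
  refine ⟨hbot', LieModule.IsIrreducible.mk fun N hN => ?_,
    envSpan_eq_top hLT le_rfl (fun y hy v hv => lie_mem_Vplus hy hv) hbot, lam, hdom, ?_, ?_⟩
  · have h1 : (N : Submodule ℂ (Vplus κ a b V B)).map
        (Vplus κ a b V B : Submodule ℂ V).subtype = hWtSp κ a b V lam := by
      refine (eq_hWtSp_of_stable (B := B) hLT ?_ ?_ ?_ ?_).1
      · exact Submodule.map_subtype_le _ _
      · rw [← hVp]; exact Submodule.map_subtype_le _ _
      · rintro y hy _ ⟨v, hv, rfl⟩
        exact ⟨_, N.lie_mem (x := (⟨y, Submodule.subset_span hy⟩ : D.tauZero H κ a b)) hv, rfl⟩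
      · exact fun h => hN (LieSubmodule.toSubmodule_injective
          (Submodule.map_injective_of_injective Subtype.val_injective
            (h.trans (Submodule.map_bot _).symm)))
    rw [eq_top_iff]
    intro v _
    have h2 : (v : V) ∈ (N : Submodule ℂ (Vplus κ a b V B)).map
        (Vplus κ a b V B : Submodule ℂ V).subtype := by
      rw [h1, ← hVp]; exact v.2
    obtain ⟨w, hw, hwv⟩ := h2
    rwa [Subtype.ext hwv] at hw
  · refine ⟨β, fun μ ⟨v, hv, hv0, hvμ⟩ => ?_⟩
    obtain ⟨q, r, rfl⟩ := exists_eq_extend_add_delta B hLT hne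
      ((Submodule.ne_bot_iff _).2 ⟨v, hvμ, hv0⟩)
    have hvq := weightSp_extend_le _ _ hvμ
    have hvl : v ∈ hWtSp κ a b V lam := by rw [← hVp]; exact hv
    refine ⟨r, ?_⟩
    have : q = lam := by
      ext h
      have h1 := (hvq h).symm.trans (hvl h)
      exact smul_left_injective ℂ hv0 h1
    rw [this]
  · rintro lam' ⟨β', h⟩
    obtain ⟨v, hv, hv0⟩ := (Submodule.ne_bot_iff _).1 hne
    obtain ⟨r, hr⟩ := h _ ⟨v, hle hv, hv0, hv⟩
    ext x
    have := congrArg (fun μ : Module.Dual ℂ (Cartan H) => μ (x, 0, 0)) hr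
    simpa [extend_apply, delta_apply] using this.symm
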